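/- Let $\mathcal P$ be a Poisson point process with unit intensity (Lebesgue measure) in the positive quadrant $\mathbb R_+^2$, regarded as a random set of points. For a positive integer $k$, a $k$-record is a point $a\in\mathcal P$ such that exactly $k-1$ points of $\mathcal P$ lie strictly south-west from $a$ (both coordinates strictly smaller). A $k$-corner is a point $a\in\mathbb R_+^2$ that either is a $k$-record, or satisfies $a\notin\mathcal P$, has exactly $k-2$ points of $\mathcal P$ strictly south-west from it, a point of $\mathcal P$ strictly west from it (same second coordinate, smaller first coordinate), and a point of $\mathcal P$ strictly south from it (same first coordinate, smaller second coordinate). Let $\mathcal R^{(k)}$ and $\mathcal C^{(k)}$ be the sets of $k$-records and of $k$-corners, and let $\tau(t,x)=t$ and $\xi(t,x)=x$ be the coordinate projections. Then: 1. the point processes $\tau(\mathcal R^{(k)})$, $k=1,2,\ldots$, are jointly independent and identically distributed, each being a Poisson process on $\mathbb R_+$ with intensity function $1/t$; 2. for every $k\ge 1$, $\tau(\mathcal C^{(k)})$ is a Poisson process on $\mathbb R_+$ with intensity function $k/t$; 3. the point processes $\xi(\mathcal R^{(k)})$, $k=1,2,\ldots$, are jointly independent and identically distributed, each being a Poisson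 process on $\mathbb R_+$ with intensity function $1/x$; 4. for every $k\ge 1$, $\xi(\mathcal C^{(k)})$ is a Poisson process on $\mathbb R_+$ with intensity function $k/x$. -/

import Mathlib

open MeasureTheory ProbabilityTheory Set
open scoped ENNReal

noncomputable section

namespace Records

/-- The counting function of a point set `S`: it sends every measurable set `B` to the number of
points of `S` in `B`. A random point set is studied through this random element of the product
space `{B // MeasurableSet B} → ℕ∞`, with the product σ-algebra (the σ-algebra generated by all
the counts `S ↦ #(S ∩ B)`). -/
def counts {E : Type*} [MeasurableSpace E] (S : Set E) : {B : Set E // MeasurableSet B} → ℕ∞ :=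
  fun B => (S ∩ B.1).encard

/-- The Poisson distribution on `{0, 1, 2, …, ∞}` with mean `r ∈ [0, ∞]`; for `r = ∞` it is the
point mass at `∞`. -/
def poissonLaw (r : ℝ≥0∞) : Measure ℕ∞ :=
  if r = ∞ then Measure.dirac ⊤ else (poissonMeasure r.toNNReal).map (fun n : ℕ => (n : ℕ∞))

/-- The random point set `X` is a Poisson point process with intensity measure `ν`: it is a point
process (its counts are random variables, up to modification on a null event), the number of
points in a measurable set `B` is Poisson distributed with mean `ν B`, and the numbers of points in
disjoint measurable sets are independent. -/
structure IsPoissonProcess {Ω E : Type*} [MeasurableSpace Ω] [MeasurableSpace E]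
    (X : Ω → Set E) (ν : Measure E) (μ : Measure Ω) : Prop where
  aemeasurable_counts : AEMeasurable (fun ω => counts (X ω)) μ
  hasLaw_encard : ∀ B : Set E, MeasurableSet B →
    HasLaw (fun ω => (X ω ∩ B).encard) (poissonLaw (ν B)) μ
  iIndepFun_encard : ∀ (n : ℕ) (B : Fin n → Set E), (∀ i, MeasurableSet (B i)) →
    Pairwise (fun i j => Disjoint (B i) (B j)) →
    iIndepFun (fun i ω => (X ω ∩ B i).encard) μ

/-- Lebesgue measure on the positive quadrant, as a measure on the plane. -/
def quadrantMeasure : Measure (ℝ × ℝ) :=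
  volume.restrict (Ioi (0 : ℝ) ×ˢ Ioi (0 : ℝ))

/-- The measure `(c / t) dt` on the positive half-line, as a measure on the line. -/
def scaleInvariantMeasure (c : ℝ) : Measure ℝ :=
  (volume.restrict (Ioi (0 : ℝ))).withDensity (fun t => ENNReal.ofReal (c / t))

/-- The points of `P` strictly south-west from `a`. -/
def southWest (P : Set (ℝ × ℝ)) (a : ℝ × ℝ) : Set (ℝ × ℝ) :=
  {b | b ∈ P ∧ b.1 < a.1 ∧ b.2 < a.2}

/-- The `k`-records of `P`: the points of `P` with exactly `k - 1` points of `P` strictly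
south-west from them. -/
def kRecords (P : Set (ℝ × ℝ)) (k : ℕ) : Set (ℝ × ℝ) :=
  {a | a ∈ P ∧ (southWest P a).encard + 1 = k}

/-- The `k`-corners of `P`: the `k`-records, together with the points `a ∉ P` having exactly
`k - 2` points of `P` strictly south-west, a point of `P` strictly west and a point of `P` strictly
south from `a`. -/
def kCorners (P : Set (ℝ × ℝ)) (k : ℕ) : Set (ℝ × ℝ) :=
  kRecords P k ∪
    {a | a ∉ P ∧ (southWest P a).encard + 2 = k ∧
      (∃ c ∈ P, c.1 < a.1 ∧ c.2 = a.2) ∧ (∃ d ∈ P, d.1 = a.1 ∧ d.2 < a.2)}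

/-- The random point sets `X k`, `k = 1, 2, …`, are independent and identically distributed, each
being a Poisson process with intensity measure `ν`. -/
def IsIIDPoisson {Ω E : Type*} [MeasurableSpace Ω] [MeasurableSpace E]
    (X : ℕ+ → Ω → Set E) (ν : Measure E) (μ : Measure Ω) : Prop :=
  (∀ k, IsPoissonProcess (X k) ν μ) ∧
  (∀ j k, IdentDistrib (fun ω => counts (X j ω)) (fun ω => counts (X k ω)) μ μ) ∧
  iIndepFun (fun k ω => counts (X k ω)) μ

end Records

end

/-! Label each point by its rank, the number of points south-west of it, and keep only its time
coordinate. Everything follows once the labelled times form a Poisson process on `ℕ × (0, ∞)` with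
intensity (counting measure) × `dt/t`: different labels then give independent processes with the
same law. Corners reduce to records, since the times of `k`-corners are the times of points of rank
less than `k`.

A second labelling has this intensity for a trivial reason. Replace the rank of `(t, x)` by `⌊t *
x⌋`: at fixed `t` each label occupies an `x`-interval of length `1/t`, so the mapping theorem
applies (`labelIntensity_prod`, `IsPoissonProcess.labelSet`). The law of a locally finite set is
determined by its void probabilities on finite unions of dyadic cells (`map_conf_eq`), so it
suffices to show that the ranks have the same void probabilities as these labels.

This is a discrete form of Ignatov's theorem. Discretize the quadrant into independent cells, empty
with probability `r`, and reveal it column by column, a column being a horizontal strip (a cell of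
the second coordinate) whose entries are indexed by time. Let `c i` be the number of columns so far
that were hit by time `i`. An occupied cell at time `i` in the next column receives rank `c i`. A
column hit by time `i` is empty at time `i` with conditional probability `keepProb r i`; hence
`avoidProb`, with one such factor for each forbidden rank not yet passed, is a martingale until a
forbidden rank occurs (`sum_column_avoidProb`), and optional stopping gives the exact identity
`sum_gridValue`.

As the mesh tends to zero, the terminal value becomes the indicator of the void event
(`IsGood.eventually_gridValue`), because infinitely many early points make the counters pass every
forbidden rank. The initial value telescopes to a product of factors `i / (i + 1) = exp (-log ((i +
1) / i))`, the void probability for `dt/t` (`tendsto_avoidProb_refine`,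
`exp_neg_labelIntensity_gridSet`). Dominated convergence joins the two in `measure_recordSet_void`.
-/

noncomputable section

namespace Records

open Filter Topology

/-! ### Records of a grid of independent Bernoulli cells -/

open Classical in
/-- The probability of the column `v` when the cells are independent and empty with probability
`r`. -/
def columnWeight (r : ℝ) {I : ℕ} (v : Fin I → Bool) : ℝ :=
  ∏ i, if v i = true then 1 - r else r

/-- Some cell of the column `v` is occupied at time `i` or earlier. -/
def HitBy {I : ℕ} (v : Fin I → Bool) (i : ℕ) : Prop :=
  ∃ i' : Fin I, (i' : ℕ) ≤ i ∧ v i' = true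

/-- The conditional probability that a column hit by time `i` is not hit at time `i`. -/
def keepProb (r : ℝ) (i : ℕ) : ℝ := r * (1 - r ^ i) / (1 - r ^ (i + 1))

lemma hitBy_snoc_of_lt {I : ℕ} (v : Fin I → Bool) (b : Bool) (i : Fin I) :
    HitBy (Fin.snoc v b : Fin (I + 1) → Bool) i ↔ HitBy v i := by
  constructor
  · rintro ⟨i', hi', h⟩
    have hlt : (i' : ℕ) < I := lt_of_le_of_lt hi' i.2
    refine ⟨⟨i', hlt⟩, hi', ?_⟩
    have : i' = Fin.castSucc ⟨i', hlt⟩ := rfl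
    rw [this, Fin.snoc_castSucc (α := fun _ => Bool)] at h
    exact h
  · rintro ⟨i', hi', h⟩
    refine ⟨i'.castSucc, hi', ?_⟩
    rw [Fin.snoc_castSucc (α := fun _ => Bool)]
    exact h

lemma hitBy_snoc_last {I : ℕ} (v : Fin I → Bool) (b : Bool) :
    HitBy (Fin.snoc v b : Fin (I + 1) → Bool) I ↔ v ≠ (fun _ => false) ∨ b = true := by
  constructor
  · rintro ⟨i', -, h⟩
    induction i' using Fin.lastCases with
    | last => right; rwa [Fin.snoc_last (α := fun _ => Bool)] at h
    | cast i =>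
      left
      rw [Fin.snoc_castSucc (α := fun _ => Bool)] at h
      intro h0
      simp [h0] at h
  · rintro (h | h)
    · obtain ⟨i, hi⟩ := Function.ne_iff.1 h
      refine ⟨i.castSucc, i.2.le, ?_⟩
      rw [Fin.snoc_castSucc (α := fun _ => Bool)]
      simpa using hi
    · refine ⟨Fin.last I, le_rfl, ?_⟩
      rwa [Fin.snoc_last (α := fun _ => Bool)]

lemma sum_snoc {I : ℕ} (G : (Fin (I + 1) → Bool) → ℝ) :
    ∑ v, G v = ∑ v : Fin I → Bool, (G (Fin.snoc v true) + G (Fin.snoc v false)) := by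
  rw [← (Fin.snocEquiv (fun _ : Fin (I + 1) => Bool)).sum_comp, Fintype.sum_prod_type,
    Fintype.sum_bool, ← Finset.sum_add_distrib]
  rfl

open Classical in
/-- The factor gained at time `i` by a column `v`, where `a i` says that the rank which the column
receives at time `i` is forbidden. -/
def columnFactor (r : ℝ) (a : ℕ → Prop) {I : ℕ} (v : Fin I → Bool) (i : Fin I) : ℝ :=
  if HitBy v i ∧ a i then (if v i = true then 0 else (keepProb r i)⁻¹) else 1

lemma pow_lt_one_of_unit {r : ℝ} (h0 : 0 < r) (h1 : r < 1) {i : ℕ} (hi : i ≠ 0) : r ^ i < 1 :=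
  pow_lt_one₀ h0.le h1 hi

lemma keepProb_pos {r : ℝ} (h0 : 0 < r) (h1 : r < 1) {i : ℕ} (hi : i ≠ 0) : 0 < keepProb r i := by
  have := pow_lt_one_of_unit h0 h1 hi
  have := pow_lt_one_of_unit h0 h1 (Nat.succ_ne_zero i)
  unfold keepProb
  apply div_pos
  · apply mul_pos h0; linarith
  · simp only [Nat.succ_eq_add_one] at this; linarith

/-- Split off the last cell. If time `I` is forbidden, a nonempty beginning contributes `r /
keepProb r I` on average, while the empty beginning, of weight `r ^ I`, survives only if the last
cell is empty. The identity `(1 - r ^ I) * r / keepProb r I + r ^ I * r = 1` is what fixes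
`keepProb`. Time `0` must be allowed: a column hit by time `0` is hit at time `0`, and `keepProb r 0
= 0`. -/
lemma sum_columnFactor {r : ℝ} (h0 : 0 < r) (h1 : r < 1) (a : ℕ → Prop) (ha : ¬ a 0) (I : ℕ) :
    ∑ v : Fin I → Bool, columnWeight r v * ∏ i, columnFactor r a v i = 1 := by
  classical
  induction I with
  | zero => simp [columnWeight]
  | succ I ih =>
    rw [sum_snoc]
    have key : ∀ (v : Fin I → Bool) (b : Bool),
        columnWeight r (Fin.snoc v b : Fin (I + 1) → Bool) *
          ∏ i, columnFactor r a (Fin.snoc v b : Fin (I + 1) → Bool) i =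
        columnWeight r v * (∏ i, columnFactor r a v i) *
          ((if b = true then 1 - r else r) *
            if (v ≠ (fun _ => false) ∨ b = true) ∧ a I then
              (if b = true then 0 else (keepProb r I)⁻¹) else 1) := by
      intro v b
      have hw : columnWeight r (Fin.snoc v b : Fin (I + 1) → Bool) =
          columnWeight r v * (if b = true then 1 - r else r) := by
        simp only [columnWeight, Fin.prod_univ_castSucc, Fin.snoc_castSucc (α := fun _ => Bool),
          Fin.snoc_last (α := fun _ => Bool)]
      have hf : ∏ i, columnFactor r a (Fin.snoc v b : Fin (I + 1) → Bool) i =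
          (∏ i, columnFactor r a v i) * (if (v ≠ (fun _ => false) ∨ b = true) ∧ a I then
              (if b = true then 0 else (keepProb r I)⁻¹) else 1) := by
        rw [Fin.prod_univ_castSucc]
        congr 1
        · refine Finset.prod_congr rfl fun i _ => ?_
          simp only [columnFactor, Fin.val_castSucc, hitBy_snoc_of_lt,
            Fin.snoc_castSucc (α := fun _ => Bool)]
        · simp only [columnFactor, Fin.val_last, hitBy_snoc_last,
            Fin.snoc_last (α := fun _ => Bool)]
      rw [hw, hf]; ring
    -- The empty column is never hit, so all its factors equal 1.
    have hz : columnWeight r (fun _ : Fin I => false) *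
        (∏ i, columnFactor r a (fun _ : Fin I => false) i) = r ^ I := by
      simp [columnWeight, columnFactor, HitBy]
    by_cases haI : a I
    · have hI : I ≠ 0 := by rintro rfl; exact ha haI
      have hp := pow_lt_one_of_unit h0 h1 hI
      have hp' := pow_lt_one_of_unit h0 h1 (Nat.succ_ne_zero I)
      -- A common multiple of the shorter summand plus a correction at the empty column alone, so
      -- that the induction hypothesis can be applied to the sum.
      have hterm : ∀ v : Fin I → Bool,
          (columnWeight r (Fin.snoc v true : Fin (I + 1) → Bool) *
            ∏ i, columnFactor r a (Fin.snoc v true : Fin (I + 1) → Bool) i) +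
          (columnWeight r (Fin.snoc v false : Fin (I + 1) → Bool) *
            ∏ i, columnFactor r a (Fin.snoc v false : Fin (I + 1) → Bool) i) =
          (r * (keepProb r I)⁻¹) * (columnWeight r v * (∏ i, columnFactor r a v i)) +
          (if v = (fun _ => false) then r ^ I * (r - r * (keepProb r I)⁻¹) else 0) := by
        intro v
        rw [key, key]
        by_cases hv : v = (fun _ => false)
        · subst hv
          rw [hz]
          simp [haI]
          ring
        · simp [hv, haI]
          ring
      rw [Finset.sum_congr rfl fun v _ => hterm v, Finset.sum_add_distrib, ← Finset.mul_sum, ih,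
        Finset.sum_ite_eq' Finset.univ]
      simp only [Finset.mem_univ, if_true, keepProb]
      have e1 : 1 - r ^ I ≠ 0 := by linarith
      have e2 : 1 - r ^ (I + 1) ≠ 0 := by simp only [Nat.succ_eq_add_one] at hp'; linarith
      field_simp
      ring
    · have hterm : ∀ v : Fin I → Bool,
          (columnWeight r (Fin.snoc v true : Fin (I + 1) → Bool) *
            ∏ i, columnFactor r a (Fin.snoc v true : Fin (I + 1) → Bool) i) +
          (columnWeight r (Fin.snoc v false : Fin (I + 1) → Bool) *
            ∏ i, columnFactor r a (Fin.snoc v false : Fin (I + 1) → Bool) i) =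
          columnWeight r v * (∏ i, columnFactor r a v i) := by
        intro v
        rw [key, key]
        simp [haI]
        ring
      rw [Finset.sum_congr rfl fun v _ => hterm v, ih]

/-- The probability that no forbidden rank occurs, when `c i` ranks are used up at time `i` and the
ranks in `A i` are forbidden at time `i`. -/
def avoidProb (r : ℝ) (A : ℕ → Finset ℕ) (I : ℕ) (c : ℕ → ℕ) : ℝ :=
  ∏ i : Fin I, keepProb r i ^ ((A i).filter (fun k => c i ≤ k)).card

-- The one-step martingale identity. A column hit by time `i` makes the counter pass the rank `c i`.
-- If that rank is forbidden, the product loses one factor `keepProb r i`, and survival requires the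
-- cell at time `i` to be empty. The ratio of new to old value is thus the product of the column
-- factors, whose mean is 1.
open Classical in
lemma sum_column_avoidProb {r : ℝ} (h0 : 0 < r) (h1 : r < 1) (A : ℕ → Finset ℕ) (hA : A 0 = ∅)
    (I : ℕ) (c : ℕ → ℕ) :
    ∑ v : Fin I → Bool, columnWeight r v *
      (if ∃ i : Fin I, v i = true ∧ c i ∈ A i then 0
        else avoidProb r A I (fun i => c i + if HitBy v i then 1 else 0)) =
    avoidProb r A I c := by
  have hterm : ∀ v : Fin I → Bool, columnWeight r v *
      (if ∃ i : Fin I, v i = true ∧ c i ∈ A i then 0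
        else avoidProb r A I (fun i => c i + if HitBy v i then 1 else 0)) =
      avoidProb r A I c * (columnWeight r v * ∏ i, columnFactor r (fun i => c i ∈ A i) v i) := by
    intro v
    split_ifs with h
    · obtain ⟨i, hi, hc⟩ := h
      have : ∏ i, columnFactor r (fun i => c i ∈ A i) v i = 0 := by
        apply Finset.prod_eq_zero (Finset.mem_univ i)
        have : HitBy v i := ⟨i, le_rfl, hi⟩
        simp [columnFactor, this, hc, hi]
      rw [this]; ring
    · have : avoidProb r A I (fun i => c i + if HitBy v i then 1 else 0) =
          avoidProb r A I c * ∏ i, columnFactor r (fun i => c i ∈ A i) v i := by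
        rw [avoidProb, avoidProb, ← Finset.prod_mul_distrib]
        refine Finset.prod_congr rfl fun i _ => ?_
        by_cases hh : HitBy v i
        · by_cases hc : c i ∈ A i
          · have hv : ¬ v i = true := fun hv => h ⟨i, hv, hc⟩
            have hi : (i : ℕ) ≠ 0 := by
              intro hi
              rw [hi, hA] at hc
              simp at hc
            have hg := (keepProb_pos h0 h1 hi).ne'
            have hcard : ((A i).filter (fun k => c i ≤ k)).card =
                ((A i).filter (fun k => c i + 1 ≤ k)).card + 1 := by
              rw [← Finset.card_insert_of_notMem (a := c i) (by simp)]
              congr 1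
              ext k
              simp only [Finset.mem_filter, Finset.mem_insert]
              constructor
              · rintro ⟨hk, hle⟩
                rcases hle.eq_or_lt with h | h
                · left; exact h.symm
                · right; exact ⟨hk, h⟩
              · rintro (rfl | ⟨hk, hle⟩)
                · exact ⟨hc, le_rfl⟩
                · exact ⟨hk, by omega⟩
            simp only [columnFactor, hh, hc, hv, and_self, if_true, hcard]
            rw [pow_succ]
            simp [hg]
          · have hfilt : (A i).filter (fun k => c i ≤ k) =
                (A i).filter (fun k => c i + 1 ≤ k) := by
              ext k
              simp only [Finset.mem_filter, and_congr_right_iff]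
              intro hk
              have : c i ≠ k := by rintro rfl; exact hc hk
              omega
            simp [columnFactor, hh, hc, hfilt]
        · simp [columnFactor, hh]
      rw [this]; ring
  rw [Finset.sum_congr rfl fun v _ => hterm v, ← Finset.mul_sum,
    sum_columnFactor h0 h1 (fun i => c i ∈ A i) (by simp [hA]), mul_one]

/-! ### From one column to the whole grid -/

open Classical in
/-- The number of columns before the `j`-th which are hit by time `i`. -/
def hitCount {n I : ℕ} (β : Fin n → Fin I → Bool) (j i : ℕ) : ℕ :=
  (Finset.univ.filter (fun j' : Fin n => (j' : ℕ) < j ∧ HitBy (β j') i)).card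

/-- Some cell of the grid `β` receives a forbidden rank, when `c i` ranks are used up at time `i`
to begin with. -/
def Violates {n I : ℕ} (A : ℕ → Finset ℕ) (c : ℕ → ℕ) (β : Fin n → Fin I → Bool) : Prop :=
  ∃ (j : Fin n) (i : Fin I), β j i = true ∧ c i + hitCount β j i ∈ A i

open Classical in
lemma hitCount_cons {n I : ℕ} (v : Fin I → Bool) (β : Fin n → Fin I → Bool) (j i : ℕ) :
    hitCount (Fin.cons v β : Fin (n + 1) → Fin I → Bool) (j + 1) i =
      (if HitBy v i then 1 else 0) + hitCount β j i := by
  unfold hitCount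
  rw [Fin.card_filter_univ_succ]
  simp only [Fin.cons_zero, Fin.val_zero, Nat.zero_lt_succ, true_and, Fin.cons_succ,
    Fin.val_succ, add_lt_add_iff_right]
  split_ifs <;> simp [add_comm]

lemma hitCount_zero {n I : ℕ} (β : Fin n → Fin I → Bool) (i : ℕ) : hitCount β 0 i = 0 := by
  simp [hitCount]

open Classical in
/-- The value of a grid configuration in the optional stopping identity. -/
def gridValue (r : ℝ) (A : ℕ → Finset ℕ) {n I : ℕ} (c : ℕ → ℕ) (β : Fin n → Fin I → Bool) : ℝ :=
  if Violates A c β then 0 else avoidProb r A I (fun i => c i + hitCount β n i)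

-- Peeling off the first column turns its hits into increments of the initial counters; this is why
-- `c` is carried as a parameter.
open Classical in
lemma gridValue_cons (r : ℝ) (A : ℕ → Finset ℕ) {n I : ℕ} (c : ℕ → ℕ) (v : Fin I → Bool)
    (β : Fin n → Fin I → Bool) :
    gridValue r A c (Fin.cons v β : Fin (n + 1) → Fin I → Bool) =
      if ∃ i : Fin I, v i = true ∧ c i ∈ A i then 0
      else gridValue r A (fun i => c i + if HitBy v i then 1 else 0) β := by
  have hviol : Violates A c (Fin.cons v β : Fin (n + 1) → Fin I → Bool) ↔
      (∃ i : Fin I, v i = true ∧ c i ∈ A i) ∨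
        Violates A (fun i => c i + if HitBy v i then 1 else 0) β := by
    simp only [Violates, Fin.exists_fin_succ, Fin.cons_zero, Fin.val_zero, hitCount_zero, add_zero,
      Fin.cons_succ, Fin.val_succ, hitCount_cons, ← add_assoc]
  simp only [gridValue, hviol, hitCount_cons, ← add_assoc]
  by_cases h : ∃ i : Fin I, v i = true ∧ c i ∈ A i
  · simp [h]
  · simp [h]

/-- Optional stopping: the one-step identity is iterated over the columns, with the counters `c`
generalized. -/
lemma sum_gridValue {r : ℝ} (h0 : 0 < r) (h1 : r < 1) (A : ℕ → Finset ℕ) (hA : A 0 = ∅)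
    (n I : ℕ) (c : ℕ → ℕ) :
    ∑ β : Fin n → Fin I → Bool, (∏ j, columnWeight r (β j)) * gridValue r A c β =
      avoidProb r A I c := by
  classical
  induction n generalizing c with
  | zero =>
    simp [gridValue, Violates, hitCount]
  | succ n ih =>
    rw [← (Fin.consEquiv (fun _ : Fin (n + 1) => Fin I → Bool)).sum_comp, Fintype.sum_prod_type,
      ← sum_column_avoidProb h0 h1 A hA I c]
    refine Finset.sum_congr rfl fun v _ => ?_
    rw [← ih, Fin.consEquiv]
    simp only [Equiv.coe_fn_mk, Fin.prod_univ_succ, Fin.cons_zero, Fin.cons_succ, gridValue_cons]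
    split_ifs with h
    · simp
    · rw [Finset.mul_sum]
      exact Finset.sum_congr rfl fun β _ => by ring

/-! ### Limits of the grid probabilities -/

/-- The factors `(1 - r ^ i) / (1 - r ^ (i + 1))` telescope. -/
lemma prod_keepProb {r : ℝ} (h0 : 0 < r) (h1 : r < 1) {a : ℕ} (ha : a ≠ 0) (d : ℕ) :
    ∏ l ∈ Finset.range d, keepProb r (a + l) = r ^ d * (1 - r ^ a) / (1 - r ^ (a + d)) := by
  have hne : ∀ b, b ≠ 0 → 1 - r ^ b ≠ 0 := fun b hb => by
    have := pow_lt_one_of_unit h0 h1 hb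
    linarith
  induction d with
  | zero => simp [hne a ha]
  | succ d ih =>
    rw [Finset.prod_range_succ, ih, keepProb]
    have := hne (a + d) (by omega)
    have := hne (a + d + 1) (by omega)
    rw [← add_assoc]
    field_simp
    ring

lemma prod_range_mul_eq {M : Type*} [CommMonoid M] (h : ℕ → M) (I d : ℕ) :
    ∏ i ∈ Finset.range (I * d), h i =
      ∏ i ∈ Finset.range I, ∏ l ∈ Finset.range d, h (i * d + l) := by
  induction I with
  | zero => simp
  | succ I ih => rw [Finset.prod_range_succ, ← ih, add_mul, one_mul, Finset.prod_range_add]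

lemma avoidProb_refine (r : ℝ) (A : ℕ → Finset ℕ) (I : ℕ) {d : ℕ} (hd : 0 < d) :
    avoidProb r (fun i => A (i / d)) (I * d) (fun _ => 0) =
      ∏ i ∈ Finset.range I,
        (∏ l ∈ Finset.range d, keepProb r (i * d + l)) ^ (A i).card := by
  rw [avoidProb, Fin.prod_univ_eq_prod_range
    (fun i => keepProb r i ^ ((A (i / d)).filter (fun k => 0 ≤ k)).card), prod_range_mul_eq]
  refine Finset.prod_congr rfl fun i _ => ?_
  rw [← Finset.prod_pow]
  refine Finset.prod_congr rfl fun l hl => ?_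
  rw [Finset.mem_range] at hl
  have : (i * d + l) / d = i := by
    rw [mul_comm, Nat.mul_add_div hd, Nat.div_eq_of_lt hl, add_zero]
  rw [this]
  simp

lemma tendsto_one_sub_exp_div {a : ℝ} :
    Tendsto (fun x : ℝ => (1 - Real.exp (-(a * x))) / x) (𝓝[≠] 0) (𝓝 a) := by
  have h : HasDerivAt (fun x : ℝ => 1 - Real.exp (-(a * x))) a 0 := by
    have h1 : HasDerivAt (fun x : ℝ => -(a * x)) (-(a * 1)) 0 := ((hasDerivAt_id 0).const_mul a).neg
    have := (h1.exp).const_sub 1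
    simpa using this
  have := h.tendsto_slope
  refine this.congr fun x => ?_
  simp [slope_def_field]

/-- Here `r` is the probability that a cell of area `(1 / 4) ^ (n + e)` is empty, and the product
runs over the fine times inside the coarse cell `i`. With `x = 2 ^ e * (1 / 4) ^ (n + e)` it
telescopes to `exp (-x) * (1 - exp (-i x)) / (1 - exp (-(i + 1) x))`, and `x` tends to 0. -/
lemma tendsto_prod_keepProb {i : ℕ} (n : ℕ) (hi : i ≠ 0) :
    Tendsto (fun e : ℕ => ∏ l ∈ Finset.range (2 ^ e),
        keepProb (Real.exp (-((1 / 4 : ℝ) ^ (n + e)))) (i * 2 ^ e + l)) atTop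
      (𝓝 ((i : ℝ) / (i + 1))) := by
  have hx : Tendsto (fun e : ℕ => (2 : ℝ) ^ e * (1 / 4 : ℝ) ^ (n + e)) atTop (𝓝[≠] 0) := by
    rw [tendsto_nhdsWithin_iff]
    constructor
    · have h := (tendsto_pow_atTop_nhds_zero_of_lt_one (r := (1 / 2 : ℝ)) (by norm_num)
        (by norm_num)).const_mul ((1 / 4 : ℝ) ^ n)
      rw [mul_zero] at h
      refine h.congr fun e => ?_
      rw [pow_add, mul_left_comm, ← mul_pow]
      norm_num
    · exact Eventually.of_forall fun e => by
        simp only [mem_compl_iff, mem_singleton_iff]; positivity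
  have hlim : Tendsto (fun x : ℝ => Real.exp (-x) * ((1 - Real.exp (-(i * x))) / x) /
      ((1 - Real.exp (-((i + 1 : ℝ) * x))) / x)) (𝓝[≠] 0) (𝓝 (1 * i / (i + 1))) := by
    refine Tendsto.div (Tendsto.mul ?_ tendsto_one_sub_exp_div) tendsto_one_sub_exp_div
      (by positivity)
    have : Tendsto (fun x : ℝ => Real.exp (-x)) (𝓝 0) (𝓝 (Real.exp (-0))) :=
      (Real.continuous_exp.comp continuous_neg).tendsto 0
    rw [neg_zero, Real.exp_zero] at this
    exact this.mono_left nhdsWithin_le_nhds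
  have h := hlim.comp hx
  rw [one_mul] at h
  refine h.congr fun e => ?_
  have h0 : (0 : ℝ) < Real.exp (-((1 / 4 : ℝ) ^ (n + e))) := Real.exp_pos _
  have h1 : Real.exp (-((1 / 4 : ℝ) ^ (n + e))) < 1 := by
    rw [Real.exp_lt_one_iff]
    simp only [neg_lt_zero]
    positivity
  rw [prod_keepProb h0 h1 (by positivity)]
  simp only [Function.comp_apply, ← Real.exp_nat_mul]
  have hne : (2 : ℝ) ^ e * (1 / 4 : ℝ) ^ (n + e) ≠ 0 := by positivity
  push_cast
  rw [mul_div_assoc', div_div_div_cancel_right₀ hne]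
  congr 3
  · ring
  · ring_nf
  · ring_nf

lemma tendsto_avoidProb_refine (A : ℕ → Finset ℕ) (hA : A 0 = ∅) (n I : ℕ) :
    Tendsto (fun e : ℕ => avoidProb (Real.exp (-((1 / 4 : ℝ) ^ (n + e))))
        (fun i => A (i / 2 ^ e)) (I * 2 ^ e) (fun _ => 0)) atTop
      (𝓝 (∏ i ∈ Finset.range I, ((i : ℝ) / (i + 1)) ^ (A i).card)) := by
  simp_rw [avoidProb_refine _ A I (pow_pos (two_pos) _)]
  refine tendsto_finsetProd _ fun i _ => ?_
  by_cases hi : i = 0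
  · subst hi
    simp [hA]
  · exact (tendsto_prod_keepProb n hi).pow _

/-! ### Dyadic cells -/

/-- The index of the dyadic cell of level `n` that contains `t`. -/
def dyadic (n : ℕ) (t : ℝ) : ℕ := ⌊2 ^ n * t⌋₊

lemma dyadic_mono (n : ℕ) : Monotone (dyadic n) := fun _ _ h =>
  Nat.floor_mono (mul_le_mul_of_nonneg_left h (by positivity))

lemma dyadic_add_div (n e : ℕ) (t : ℝ) : dyadic (n + e) t / 2 ^ e = dyadic n t := by
  have := Nat.floor_div_natCast (2 ^ (n + e) * t) (2 ^ e)
  unfold dyadic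
  rw [← this]
  congr 1
  push_cast
  rw [pow_add]
  field_simp

lemma measurable_dyadic (n : ℕ) : Measurable (dyadic n) :=
  Nat.measurable_floor.comp (measurable_const_mul _)

lemma dyadic_lt_of_one_le {m : ℕ} {x y : ℝ} (hx : 0 ≤ x) (h : 1 ≤ 2 ^ m * (y - x)) :
    dyadic m x < dyadic m y := by
  have h2 : (0 : ℝ) ≤ 2 ^ m * x := by positivity
  have : ⌊(2 : ℝ) ^ m * x + 1⌋₊ ≤ ⌊(2 : ℝ) ^ m * y⌋₊ := Nat.floor_mono (by linarith)
  rw [Nat.floor_add_one h2] at this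
  exact this

lemma eventually_one_le_two_pow_mul {δ : ℝ} (h : 0 < δ) : ∀ᶠ m : ℕ in atTop, 1 ≤ 2 ^ m * δ :=
  ((tendsto_pow_atTop_atTop_of_one_lt (one_lt_two : (1 : ℝ) < 2)).atTop_mul_const
    h).eventually_ge_atTop 1

lemma eventually_dyadic_lt {x y : ℝ} (hx : 0 ≤ x) (h : x < y) :
    ∀ᶠ m in atTop, dyadic m x < dyadic m y :=
  (eventually_one_le_two_pow_mul (sub_pos.2 h)).mono fun _ => dyadic_lt_of_one_le hx

/-- On a finite set of nonnegative reals, all fine dyadic cell indices preserve strict order. -/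
lemma eventually_dyadic_strictMonoOn {T : Set ℝ} (hT : T.Finite) (h0 : ∀ t ∈ T, 0 ≤ t) :
    ∀ᶠ m in atTop, StrictMonoOn (dyadic m) T := by
  have : ∀ᶠ m in atTop, ∀ x ∈ T, ∀ y ∈ T, x < y → dyadic m x < dyadic m y := by
    rw [eventually_all_finite hT]
    intro x hx
    rw [eventually_all_finite hT]
    intro y hy
    by_cases hxy : x < y
    · filter_upwards [eventually_dyadic_lt (h0 x hx) hxy] with m hm _ using hm
    · exact Eventually.of_forall fun m h => absurd h hxy
  filter_upwards [this] with m hm x hx y hy hxy using hm x hx y hy hxy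

/-- The union of the cells `{k} × [i / 2 ^ n, (i + 1) / 2 ^ n)`, `i < I`, `k ∈ A i`. -/
def gridSet (n : ℕ) (A : ℕ → Finset ℕ) (I : ℕ) : Set (ℕ × ℝ) :=
  {q | dyadic n q.2 < I ∧ q.1 ∈ A (dyadic n q.2)}

lemma gridSet_refine (n e : ℕ) (A : ℕ → Finset ℕ) (I : ℕ) :
    gridSet n A I = gridSet (n + e) (fun i => A (i / 2 ^ e)) (I * 2 ^ e) := by
  ext q
  simp only [gridSet, mem_ofPred_eq, dyadic_add_div]
  rw [← Nat.div_lt_iff_lt_mul (by positivity), dyadic_add_div]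

lemma gridSet_union (n : ℕ) (A A' : ℕ → Finset ℕ) (I I' : ℕ) :
    gridSet n A I ∪ gridSet n A' I' =
      gridSet n (fun i => (if i < I then A i else ∅) ∪ (if i < I' then A' i else ∅))
        (max I I') := by
  ext q
  simp only [gridSet, mem_union, mem_ofPred_eq, Finset.mem_union, lt_max_iff]
  split_ifs with h h' <;> simp [h] <;> simp_all

lemma measurableSet_gridSet (n : ℕ) (A : ℕ → Finset ℕ) (I : ℕ) : MeasurableSet (gridSet n A I) := by
  have h : Measurable (fun q : ℕ × ℝ => (q.1, dyadic n q.2)) :=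
    measurable_fst.prodMk ((measurable_dyadic n).comp measurable_snd)
  exact h (MeasurableSet.of_discrete (s := {p : ℕ × ℕ | p.2 < I ∧ p.1 ∈ A p.2}))

/-- Finite unions of dyadic cells away from time zero. -/
def gridSets : Set (Set (ℕ × ℝ)) := {U | ∃ n A I, A 0 = ∅ ∧ U = gridSet n A I}

lemma measurableSet_of_mem_gridSets {U : Set (ℕ × ℝ)} (hU : U ∈ gridSets) : MeasurableSet U := by
  obtain ⟨n, A, I, -, rfl⟩ := hU
  exact measurableSet_gridSet n A I

lemma union_mem_gridSets {U V : Set (ℕ × ℝ)} (hU : U ∈ gridSets) (hV : V ∈ gridSets) :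
    U ∪ V ∈ gridSets := by
  obtain ⟨n, A, I, hA, rfl⟩ := hU
  obtain ⟨n', A', I', hA', rfl⟩ := hV
  rw [gridSet_refine n n', gridSet_refine n' n, add_comm n' n, gridSet_union]
  exact ⟨_, _, _, by simp [hA, hA'], rfl⟩

/-! ### Locally finite configurations on `ℕ × (0, ∞)` -/

/-- An exhausting sequence of windows in `ℕ × (0, ∞)`. -/
def window (n : ℕ) : Set (ℕ × ℝ) := {q | q.1 ≤ n ∧ 1 ≤ 2 ^ n * q.2 ∧ q.2 < 2 ^ n}

lemma pos_of_one_le_two_pow_mul {m : ℕ} {t : ℝ} (h : 1 ≤ 2 ^ m * t) : 0 < t :=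
  pos_of_mul_pos_right (zero_lt_one.trans_le h) (by positivity)

lemma exists_mem_window {q : ℕ × ℝ} (hq : 0 < q.2) : ∃ n, q ∈ window n := by
  have h1 := eventually_ge_atTop q.1
  have h2 := eventually_one_le_two_pow_mul hq
  have h3 := (tendsto_pow_atTop_atTop_of_one_lt (one_lt_two : (1 : ℝ) < 2)).eventually_gt_atTop q.2
  obtain ⟨n, hn⟩ := (h1.and (h2.and h3)).exists
  exact ⟨n, hn⟩

/-- A set of labelled positive times which is locally finite. -/
structure IsConf (S : Set (ℕ × ℝ)) : Prop where
  pos : ∀ q ∈ S, 0 < q.2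
  finite : ∀ n, (S ∩ window n).Finite

lemma IsConf.mono {S T : Set (ℕ × ℝ)} (h : IsConf T) (hST : S ⊆ T) : IsConf S :=
  ⟨fun q hq => h.pos q (hST hq), fun n => (h.finite n).subset (inter_subset_inter_left _ hST)⟩

lemma isConf_empty : IsConf ∅ := ⟨by simp, by simp⟩

/-- The space of locally finite sets of labelled positive times. -/
def Conf : Type := {S : Set (ℕ × ℝ) // IsConf S}

/-- The configurations without points in `U`. -/
def voidEvent (U : Set (ℕ × ℝ)) : Set Conf := {S | S.1 ∩ U = ∅}

/-- The void events of finite unions of dyadic cells. -/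
def voidEvents : Set (Set Conf) := voidEvent '' gridSets

/-- The σ-algebra on configurations generated by the void events of finite unions of cells. -/
instance : MeasurableSpace Conf := MeasurableSpace.generateFrom voidEvents

lemma voidEvent_inter (U V : Set (ℕ × ℝ)) :
    voidEvent U ∩ voidEvent V = voidEvent (U ∪ V) := by
  ext S
  simp [voidEvent, inter_union_distrib_left]

lemma isPiSystem_voidEvents : IsPiSystem voidEvents := by
  rintro _ ⟨U, hU, rfl⟩ _ ⟨V, hV, rfl⟩ -
  rw [voidEvent_inter]
  exact ⟨_, union_mem_gridSets hU hV, rfl⟩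

lemma measurableSet_voidEvent {U : Set (ℕ × ℝ)} (hU : U ∈ gridSets) :
    MeasurableSet (voidEvent U) :=
  MeasurableSpace.measurableSet_generateFrom ⟨U, hU, rfl⟩

lemma measurable_conf_iff {Ω : Type*} [MeasurableSpace Ω] {X : Ω → Conf} :
    Measurable X ↔ ∀ U ∈ gridSets, MeasurableSet {ω | (X ω).1 ∩ U = ∅} := by
  constructor
  · intro h U hU
    exact h (measurableSet_voidEvent hU)
  · intro h
    refine measurable_generateFrom ?_
    rintro _ ⟨U, hU, rfl⟩
    exact h U hU

/-- Void events are stable under intersection, because avoiding `U` and `V` is avoiding `U ∪ V`.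
They form a π-system generating the σ-algebra, so void probabilities determine the law. -/
lemma map_conf_eq {Ω : Type*} [MeasurableSpace Ω] {μ : Measure Ω} [IsProbabilityMeasure μ]
    {X Y : Ω → Conf} (hX : Measurable X) (hY : Measurable Y)
    (h : ∀ U ∈ gridSets, μ {ω | (X ω).1 ∩ U = ∅} = μ {ω | (Y ω).1 ∩ U = ∅}) :
    μ.map X = μ.map Y := by
  have := Measure.isProbabilityMeasure_map hX.aemeasurable (μ := μ)
  have := Measure.isProbabilityMeasure_map hY.aemeasurable (μ := μ)
  refine ext_of_generate_finite voidEvents rfl isPiSystem_voidEvents ?_ (by simp)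
  rintro _ ⟨U, hU, rfl⟩
  rw [Measure.map_apply hX (measurableSet_voidEvent hU),
    Measure.map_apply hY (measurableSet_voidEvent hU)]
  exact h U hU

lemma IsConf.countable {S : Set (ℕ × ℝ)} (h : IsConf S) : S.Countable := by
  have : S = ⋃ n, S ∩ window n := by
    rw [← inter_iUnion, eq_comm, inter_eq_left]
    intro q hq
    exact mem_iUnion.2 (exists_mem_window (h.pos q hq))
  rw [this]
  exact countable_iUnion fun n => (h.finite n).countable

/-! ### Measurability of counts with respect to the void events -/

/-- The times of the points of `S` with label `k` in the `n`-th window. -/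
def slice (S : Set (ℕ × ℝ)) (k n : ℕ) : Set ℝ := {t | (k, t) ∈ S ∧ 1 ≤ 2 ^ n * t ∧ t < 2 ^ n}

lemma IsConf.slice_finite {S : Set (ℕ × ℝ)} (h : IsConf S) (k n : ℕ) : (slice S k n).Finite := by
  have hf := (h.finite (max k n)).image Prod.snd
  refine hf.subset ?_
  rintro t ⟨h1, h2, h3⟩
  have ht := h.pos _ h1
  have hpow : (2 : ℝ) ^ n ≤ 2 ^ (max k n) := pow_le_pow_right₀ one_le_two (le_max_right _ _)
  exact ⟨(k, t), ⟨h1, le_max_left _ _, h2.trans (mul_le_mul_of_nonneg_right hpow ht.le),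
    h3.trans_le hpow⟩, rfl⟩

lemma slice_mono (S : Set (ℕ × ℝ)) (k : ℕ) : Monotone (slice S k) := by
  intro m n hmn t ⟨h1, h2, h3⟩
  have hpow : (2 : ℝ) ^ m ≤ 2 ^ n := pow_le_pow_right₀ one_le_two hmn
  exact ⟨h1, h2.trans (mul_le_mul_of_nonneg_right hpow (pos_of_one_le_two_pow_mul h2).le),
    h3.trans_le hpow⟩

lemma IsConf.iUnion_slice {S : Set (ℕ × ℝ)} (h : IsConf S) (k : ℕ) :
    ⋃ n, slice S k n = {t | (k, t) ∈ S} := by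
  ext t
  simp only [mem_iUnion]
  constructor
  · rintro ⟨n, hn⟩; exact hn.1
  · intro ht
    obtain ⟨n, hn⟩ := exists_mem_window (h.pos _ ht)
    exact ⟨n, ht, hn.2⟩

/-- The configuration `S` has a point with label `k` in the `i`-th cell of level `m`. -/
def occupied (k m i : ℕ) : Set Conf := {S | ∃ t, (k, t) ∈ S.1 ∧ dyadic m t = i}

lemma measurableSet_occupied (k m : ℕ) {i : ℕ} (hi : i ≠ 0) :
    MeasurableSet (occupied k m i) := by
  have : occupied k m i =
      (voidEvent (gridSet m (fun i' => if i' = i then {k} else ∅) (i + 1)))ᶜ := by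
    ext S
    simp only [occupied, voidEvent, mem_ofPred_eq, mem_compl_iff, ← nonempty_iff_ne_empty, gridSet,
      ← ne_eq]
    constructor
    · rintro ⟨t, ht, rfl⟩
      exact ⟨(k, t), ht, by simp⟩
    · rintro ⟨⟨k', t⟩, ht, h1, h2⟩
      simp only at h1 h2
      split_ifs at h2 with h
      · simp only [Finset.mem_singleton] at h2
        subst h2
        exact ⟨t, ht, h⟩
      · simp at h2
  rw [this]
  exact (measurableSet_voidEvent ⟨_, _, _, by simp [hi.symm], rfl⟩).compl

open Classical in
/-- The cells of level `n + e` inside the `n`-th window and to the left of `a`. -/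
def cellsBelow (n : ℕ) (a : ℝ) (e : ℕ) : Finset ℕ :=
  (Finset.range (2 ^ (n + n + e))).filter
    (fun i => i ≠ 0 ∧ 2 ^ e ≤ i ∧ (i + 1 : ℝ) ≤ 2 ^ (n + e) * a)

lemma one_le_two_pow_mul_iff (n e : ℕ) (t : ℝ) :
    1 ≤ (2 : ℝ) ^ n * t ↔ 2 ^ e ≤ dyadic (n + e) t := by
  rw [dyadic, Nat.le_floor_iff' (by positivity), pow_add]
  push_cast
  rw [mul_comm ((2 : ℝ) ^ n) (2 ^ e), mul_assoc, le_mul_iff_one_le_right (by positivity)]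

lemma lt_two_pow_iff {n e : ℕ} {t : ℝ} (ht : 0 ≤ t) :
    t < (2 : ℝ) ^ n ↔ dyadic (n + e) t < 2 ^ (n + n + e) := by
  rw [dyadic, Nat.floor_lt (by positivity)]
  push_cast
  rw [show (2 : ℝ) ^ (n + n + e) = 2 ^ (n + e) * 2 ^ n by ring,
    mul_lt_mul_iff_right₀ (by positivity)]

-- The slice is finite. On a fine grid its times lie in different cells, and each time before `a`
-- lies in a cell entirely to the left of `a`, so counting occupied cells counts points.
open Classical in
lemma IsConf.eventually_card_cellsBelow (S : Conf) (k n : ℕ) (a : ℝ) :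
    ∀ᶠ e in atTop, (((cellsBelow n a e).filter (fun i => S ∈ occupied k (n + e) i)).card : ℕ∞) =
      (slice S.1 k n ∩ Iio a).encard := by
  have hfin := S.2.slice_finite k n
  have h0 : ∀ t ∈ slice S.1 k n, 0 < t := fun t ht => pos_of_one_le_two_pow_mul ht.2.1
  have h1 : ∀ᶠ e in atTop, StrictMonoOn (dyadic (n + e)) (slice S.1 k n) :=
    (tendsto_add_atTop_nat n |>.congr fun e => add_comm e n).eventually
      (eventually_dyadic_strictMonoOn hfin fun t ht => (h0 t ht).le)
  have h2 : ∀ᶠ e in atTop, ∀ t ∈ slice S.1 k n, t < a → 1 ≤ 2 ^ (n + e) * (a - t) := by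
    rw [eventually_all_finite hfin]
    intro t ht
    by_cases hta : t < a
    · filter_upwards [(tendsto_add_atTop_nat n |>.congr fun e => add_comm e n).eventually
        (eventually_one_le_two_pow_mul (sub_pos.2 hta))] with e he _ using he
    · exact Eventually.of_forall fun e h => absurd h hta
  filter_upwards [h1, h2] with e he1 he2
  have himage : (((cellsBelow n a e).filter (fun i => S ∈ occupied k (n + e) i) : Finset ℕ) :
      Set ℕ) = dyadic (n + e) '' (slice S.1 k n ∩ Iio a) := by
    ext i
    rw [Finset.mem_coe, Finset.mem_filter, cellsBelow, Finset.mem_filter, Finset.mem_range]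
    constructor
    · rintro ⟨⟨hi1, hi2, hi3, hi4⟩, t, ht, rfl⟩
      refine ⟨t, ⟨⟨ht, ?_, ?_⟩, ?_⟩, rfl⟩
      · exact (one_le_two_pow_mul_iff n e t).2 hi3
      · exact (lt_two_pow_iff (S.2.pos _ ht).le).2 hi1
      · have := Nat.lt_floor_add_one ((2 : ℝ) ^ (n + e) * t)
        have h4 := this.trans_le hi4
        exact (mul_lt_mul_iff_right₀ (by positivity)).1 h4
    · rintro ⟨t, ⟨ht, hta⟩, rfl⟩
      have hge := (one_le_two_pow_mul_iff n e t).1 ht.2.1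
      refine ⟨⟨(lt_two_pow_iff (h0 t ht).le).1 ht.2.2, ?_, hge, ?_⟩, t, ht.1, rfl⟩
      · have : 0 < 2 ^ e := by positivity
        omega
      · have := he2 t ht hta
        have h3 := Nat.floor_le (a := (2 : ℝ) ^ (n + e) * t)
          (mul_nonneg (by positivity) (h0 t ht).le)
        simp only [dyadic]
        linarith
  rw [← encard_coe_eq_coe_finsetCard, himage,
    InjOn.encard_image (he1.injOn.mono inter_subset_left)]

/-- The counting measure of the times with label `k` in the `n`-th window. -/
def sliceMeasure (k n : ℕ) (S : Conf) : Measure ℝ := Measure.count.restrict (slice S.1 k n)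

instance (k n : ℕ) (S : Conf) : IsFiniteMeasure (sliceMeasure k n S) :=
  ⟨by
    rw [sliceMeasure, Measure.restrict_apply_univ]
    exact Measure.count_apply_lt_top.2 (S.2.slice_finite k n)⟩

lemma sliceMeasure_apply (k n : ℕ) (S : Conf) {B : Set ℝ} (hB : MeasurableSet B) :
    sliceMeasure k n S B = ((slice S.1 k n ∩ B).encard : ℝ≥0∞) := by
  rw [sliceMeasure, Measure.restrict_apply hB, inter_comm,
    Measure.count_apply ((S.2.slice_finite k n).measurableSet.inter hB)]

lemma measurable_sliceMeasure_Iio (k n : ℕ) (a : ℝ) :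
    Measurable (fun S => sliceMeasure k n S (Iio a)) := by
  classical
  have hlim : Tendsto (fun (e : ℕ) (S : Conf) => ∑ i ∈ cellsBelow n a e,
      (occupied k (n + e) i).indicator (fun _ => (1 : ℝ≥0∞)) S) atTop
      (𝓝 (fun S => sliceMeasure k n S (Iio a))) := by
    rw [tendsto_pi_nhds]
    intro S
    refine tendsto_const_nhds.congr' ?_
    filter_upwards [IsConf.eventually_card_cellsBelow S k n a] with e he
    rw [sliceMeasure_apply _ _ _ measurableSet_Iio, ← he]
    simp only [indicator_apply, Finset.sum_boole, ENat.toENNReal_coe]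
  refine measurable_of_tendsto_metrizable (fun e => ?_) hlim
  refine Finset.measurable_fun_sum _ fun i hi => ?_
  refine measurable_const.indicator (measurableSet_occupied k (n + e) ?_)
  simp only [cellsBelow, Finset.mem_filter] at hi
  exact hi.2.1

lemma measurable_sliceMeasure (k n : ℕ) : Measurable (sliceMeasure k n) := by
  refine Measurable.measure_of_isPiSystem (borel_eq_generateFrom_Iio ℝ ▸
    (inferInstance : BorelSpace ℝ).measurable_eq) isPiSystem_Iio ?_ ?_
  · rintro _ ⟨a, rfl⟩
    exact measurable_sliceMeasure_Iio k n a
  -- The slice has no times from `2 ^ n` on, so its total mass is the mass of a half-line.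
  · convert measurable_sliceMeasure_Iio k n (2 ^ n) using 2 with S
    rw [sliceMeasure_apply _ _ _ MeasurableSet.univ, sliceMeasure_apply _ _ _ measurableSet_Iio]
    congr 2
    ext t
    simp only [inter_univ, mem_inter_iff, mem_Iio, iff_self_and]
    exact fun h => h.2.2

/-- Expresses a count through the finite measures of the slices, by a sum over labels and an
increasing limit over windows; both operations preserve measurability. -/
lemma IsConf.encard_inter_eq_tsum (S : Conf) {B : Set (ℕ × ℝ)} (hB : MeasurableSet B) :
    ((S.1 ∩ B).encard : ℝ≥0∞) =
      ∑' k : ℕ, ⨆ n, sliceMeasure k n S {t | (k, t) ∈ B} := by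
  have hS := S.2.countable
  have hsec : ∀ k : ℕ, MeasurableSet {t : ℝ | (k, t) ∈ B} := fun k =>
    measurable_prodMk_left hB
  have h1 : S.1 ∩ B = ⋃ k : ℕ, Prod.mk k '' ({t | (k, t) ∈ S.1} ∩ {t | (k, t) ∈ B}) := by
    ext ⟨k, t⟩
    simp
  have hc : ∀ k : ℕ, ({t : ℝ | (k, t) ∈ S.1}).Countable := fun k => by
    rw [← S.2.iUnion_slice k]
    exact countable_iUnion fun n => (S.2.slice_finite k n).countable
  rw [← Measure.count_apply (hS.measurableSet.inter hB), h1, measure_iUnion]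
  · congr 1
    ext k
    rw [Measure.count_injective_image (Prod.mk_right_injective k), ← S.2.iUnion_slice k,
      iUnion_inter, Monotone.measure_iUnion]
    · congr 1
      ext n
      rw [sliceMeasure, Measure.restrict_apply (hsec k), inter_comm]
    · exact fun m n hmn => inter_subset_inter_left _ (slice_mono S.1 k hmn)
  · intro k k' hkk'
    rw [Function.onFun, disjoint_left]
    rintro _ ⟨t, -, rfl⟩ ⟨t', -, h⟩
    exact hkk' (Prod.ext_iff.1 h).1.symm
  · intro k
    exact (((hc k).mono inter_subset_left).image _).measurableSet

lemma measurable_encard_of_toENNReal {Ω : Type*} [MeasurableSpace Ω] {f : Ω → ℕ∞}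
    (h : Measurable (fun ω => (f ω : ℝ≥0∞))) : Measurable f := by
  refine measurable_to_countable' fun l => ?_
  have : f ⁻¹' {l} = (fun ω => (f ω : ℝ≥0∞)) ⁻¹' {(l : ℝ≥0∞)} := by
    ext ω
    simp
  rw [this]
  exact h (measurableSet_singleton _)

lemma measurable_encard_conf {B : Set (ℕ × ℝ)} (hB : MeasurableSet B) :
    Measurable (fun S : Conf => (S.1 ∩ B).encard) := by
  refine measurable_encard_of_toENNReal ?_
  simp_rw [fun S => IsConf.encard_inter_eq_tsum S hB]
  refine Measurable.tsum fun k => Measurable.iSup fun n => ?_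
  exact (Measure.measurable_coe (measurable_prodMk_left hB)).comp (measurable_sliceMeasure k n)

lemma measurable_counts_conf : Measurable (fun S : Conf => counts S.1) :=
  measurable_pi_lambda _ fun B => measurable_encard_conf B.2

/-! ### Records of a locally finite planar set -/

/-- The properties of almost all realizations of the Poisson process. -/
structure IsGood (S : Set (ℝ × ℝ)) : Prop where
  pos : ∀ p ∈ S, 0 < p.1 ∧ 0 < p.2
  finite : ∀ n : ℕ, (S ∩ {p | p.1 < n ∧ p.2 < n}).Finite
  infinite : ∀ n : ℕ, (S ∩ {p | 2 ^ n * p.1 < 1}).Infinite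
  injOn_fst : InjOn Prod.fst S
  injOn_snd : InjOn Prod.snd S

/-- The times of the records, labelled by the number of points south-west of them. -/
def recordSet (S : Set (ℝ × ℝ)) : Set (ℕ × ℝ) :=
  {q | ∃ x, (q.2, x) ∈ S ∧ (southWest S (q.2, x)).encard = q.1}

/-- The times of the points, labelled by the integer part of the area south-west of them. -/
def labelSet (S : Set (ℝ × ℝ)) : Set (ℕ × ℝ) :=
  (fun p : ℝ × ℝ => (⌊p.1 * p.2⌋₊, p.1)) '' S

lemma IsGood.finite_real {S : Set (ℝ × ℝ)} (h : IsGood S) (a b : ℝ) :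
    (S ∩ {p | p.1 < a ∧ p.2 < b}).Finite := by
  obtain ⟨n, hn⟩ := exists_nat_ge (max a b)
  refine (h.finite n).subset (inter_subset_inter_right _ ?_)
  rintro p ⟨h1, h2⟩
  exact ⟨h1.trans_le ((le_max_left _ _).trans hn), h2.trans_le ((le_max_right _ _).trans hn)⟩

/-- Arbitrarily many points occur before any given positive time. -/
lemma IsGood.exists_early {S : Set (ℝ × ℝ)} (h : IsGood S) (n K : ℕ) :
    ∃ (T : Finset (ℝ × ℝ)) (M : ℝ), (T : Set (ℝ × ℝ)) ⊆ S ∧ T.card = K ∧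
      ∀ p ∈ T, 2 ^ n * p.1 < 1 ∧ p.2 < M := by
  obtain ⟨T, hT, hc⟩ := (h.infinite n).exists_subset_card_eq K
  obtain ⟨M, hM⟩ := (T.image Prod.snd).finite_toSet.bddAbove
  refine ⟨T, M + 1, fun p hp => (hT hp).1, hc, fun p hp => ⟨(hT hp).2, ?_⟩⟩
  have := hM (Finset.mem_coe.2 (Finset.mem_image_of_mem Prod.snd hp))
  linarith

lemma card_le_encard_southWest {S : Set (ℝ × ℝ)} {T : Finset (ℝ × ℝ)} {M : ℝ} {n : ℕ}
    (hTS : (T : Set (ℝ × ℝ)) ⊆ S) (hT : ∀ p ∈ T, 2 ^ n * p.1 < 1 ∧ p.2 < M) {a : ℝ × ℝ}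
    (h1 : 1 ≤ 2 ^ n * a.1) (h2 : M ≤ a.2) : (T.card : ℕ∞) ≤ (southWest S a).encard := by
  rw [← encard_coe_eq_coe_finsetCard]
  refine encard_le_encard fun p hp => ⟨hTS hp, ?_, (hT p hp).2.trans_le h2⟩
  exact (mul_lt_mul_iff_right₀ (by positivity)).1 ((hT p hp).1.trans_le h1)

/-- Some `n + 1` points lie before time `2⁻ⁿ` and below a height `M`. They are south-west of every
point of the window that lies at height `M` or above, whose rank therefore exceeds `n`. Only the
finitely many points below `M` remain. -/
lemma IsGood.isConf_recordSet {S : Set (ℝ × ℝ)} (h : IsGood S) : IsConf (recordSet S) := by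
  refine ⟨fun q ⟨x, hx, _⟩ => (h.pos _ hx).1, fun n => ?_⟩
  obtain ⟨T, M, hTS, hc, hT⟩ := h.exists_early n (n + 1)
  refine ((h.finite_real (2 ^ n) M).image
    (fun p => ((southWest S p).encard.toNat, p.1))).subset ?_
  rintro ⟨k, t⟩ ⟨⟨x, hx, hk⟩, hkn, ht1, ht2⟩
  refine ⟨(t, x), ⟨hx, ht2, ?_⟩, ?_⟩
  · by_contra hM
    have := card_le_encard_southWest hTS hT (a := (t, x)) ht1 (not_lt.1 hM)
    simp only at hk hkn
    rw [hk, hc] at this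
    have : n + 1 ≤ k := by exact_mod_cast this
    omega
  · simp only at hk ⊢
    rw [hk]
    simp

lemma IsGood.isConf_labelSet {S : Set (ℝ × ℝ)} (h : IsGood S) : IsConf (labelSet S) := by
  refine ⟨?_, fun n => ?_⟩
  · rintro _ ⟨p, hp, rfl⟩
    exact (h.pos p hp).1
  · refine ((h.finite_real (2 ^ n) ((n + 1) * 2 ^ n)).image
      (fun p : ℝ × ℝ => (⌊p.1 * p.2⌋₊, p.1))).subset ?_
    rintro _ ⟨⟨p, hp, rfl⟩, h1, h2, h3⟩
    refine ⟨p, ⟨hp, h3, ?_⟩, rfl⟩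
    simp only at h1 h2
    have hlt : p.1 * p.2 < n + 1 := by
      have := Nat.lt_floor_add_one (p.1 * p.2)
      have h1' : ((⌊p.1 * p.2⌋₊ : ℕ) : ℝ) ≤ n := by exact_mod_cast h1
      linarith
    have hp2 := (h.pos p hp).2
    calc p.2 ≤ (2 ^ n * p.1) * p.2 := le_mul_of_one_le_left hp2.le h2
      _ = (p.1 * p.2) * 2 ^ n := by ring
      _ < (n + 1) * 2 ^ n := mul_lt_mul_of_pos_right hlt (by positivity)

/-- Distinct points have distinct times. This allows labels to be forgotten without losing
multiplicity when corners are counted. -/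
lemma IsGood.injOn_snd_recordSet {S : Set (ℝ × ℝ)} (h : IsGood S) :
    InjOn Prod.snd (recordSet S) := by
  rintro ⟨k, t⟩ ⟨x, hx, hk⟩ ⟨k', t'⟩ ⟨x', hx', hcard⟩ htt
  simp only at hx hk hx' hcard htt
  subst htt
  have := h.injOn_fst hx hx' rfl
  rw [← this, hk] at hcard
  simp only [Prod.mk.injEq, and_true]
  exact_mod_cast hcard

/-! ### Discretization of the records -/

open Classical in
/-- The occupied cells of level `m`, in `N` columns and up to time index `I`. -/
def occGrid (m N I : ℕ) (S : Set (ℝ × ℝ)) : Fin N → Fin I → Bool := fun j i =>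
  decide (∃ p ∈ S, dyadic m p.1 = i ∧ dyadic m p.2 = j)

lemma hitBy_occGrid {m N I : ℕ} {S : Set (ℝ × ℝ)} {j : Fin N} {i : ℕ} (hi : i < I) :
    HitBy (occGrid m N I S j) i ↔ ∃ p ∈ S, dyadic m p.1 ≤ i ∧ dyadic m p.2 = j := by
  simp only [HitBy, occGrid, decide_eq_true_eq]
  constructor
  · rintro ⟨i', hi', p, hp, h1, h2⟩
    exact ⟨p, hp, h1.trans_le hi', h2⟩
  · rintro ⟨p, hp, h1, h2⟩
    exact ⟨⟨_, h1.trans_lt hi⟩, h1, p, hp, rfl, h2⟩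

lemma coe_hitCount_occGrid {m N I : ℕ} {S : Set (ℝ × ℝ)} {j i : ℕ} (hi : i < I) :
    (hitCount (occGrid m N I S) j i : ℕ∞) =
      {j' : ℕ | j' < N ∧ j' < j ∧ ∃ p ∈ S, dyadic m p.1 ≤ i ∧ dyadic m p.2 = j'}.encard := by
  classical
  rw [hitCount, ← Finset.card_map Fin.valEmbedding, ← encard_coe_eq_coe_finsetCard]
  congr 1
  ext j'
  simp only [Finset.coe_map, mem_image, Finset.mem_coe, Finset.mem_filter, Finset.mem_univ,
    true_and, Fin.valEmbedding_apply, hitBy_occGrid hi, mem_ofPred_eq]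
  constructor
  · rintro ⟨l, h, rfl⟩
    exact ⟨l.2, h⟩
  · rintro ⟨h1, h2⟩
    exact ⟨⟨j', h1⟩, h2, rfl⟩

/-- Sufficiently fine grids resolve the points with `p.1 < b` and `p.2 < M`. -/
structure Resolves (S : Set (ℝ × ℝ)) (b M : ℝ) (m : ℕ) : Prop where
  fst : StrictMonoOn (dyadic m) (Prod.fst '' (S ∩ {p | p.1 < b ∧ p.2 < M}))
  snd : StrictMonoOn (dyadic m) (Prod.snd '' (S ∩ {p | p.1 < b ∧ p.2 < M}))
  le : M ≤ m

lemma IsGood.eventually_resolves {S : Set (ℝ × ℝ)} (h : IsGood S) (b M : ℝ) :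
    ∀ᶠ m in atTop, Resolves S b M m := by
  have hfin := h.finite_real b M
  have h1 := eventually_dyadic_strictMonoOn (hfin.image Prod.fst) (by
    rintro _ ⟨p, hp, rfl⟩; exact (h.pos p hp.1).1.le)
  have h2 := eventually_dyadic_strictMonoOn (hfin.image Prod.snd) (by
    rintro _ ⟨p, hp, rfl⟩; exact (h.pos p hp.1).2.le)
  filter_upwards [h1, h2, tendsto_natCast_atTop_atTop.eventually_ge_atTop M] with m a1 a2 a3
  exact ⟨a1, a2, a3⟩

lemma dyadic_lt_mul_two_pow {m : ℕ} {x : ℝ} (hx : 0 ≤ x) (h : x < m) :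
    dyadic m x < m * 2 ^ m := by
  rw [dyadic, Nat.floor_lt (by positivity)]
  push_cast
  rw [mul_comm]
  exact mul_lt_mul_of_pos_right h (by positivity)

lemma lt_of_dyadic_lt {n e I : ℕ} {t : ℝ} (h : dyadic (n + e) t < I * 2 ^ e) : t < I / 2 ^ n := by
  have h1 : (2 : ℝ) ^ (n + e) * t < (I * 2 ^ e : ℕ) := by
    have h3 := Nat.lt_floor_add_one ((2 : ℝ) ^ (n + e) * t)
    have h4 : (dyadic (n + e) t : ℝ) + 1 ≤ (I * 2 ^ e : ℕ) := by exact_mod_cast h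
    unfold dyadic at h4
    linarith
  rw [lt_div_iff₀ (by positivity)]
  have h2 : (0 : ℝ) < 2 ^ e := by positivity
  push_cast at h1
  rw [pow_add] at h1
  nlinarith

/-- On a resolving grid, the number of columns hit before a point is its number of south-west
neighbours. -/
lemma IsGood.coe_hitCount_eq {S : Set (ℝ × ℝ)} (h : IsGood S) {n e I : ℕ} {M : ℝ}
    (hR : Resolves S (I / 2 ^ n + 1) M (n + e)) {p : ℝ × ℝ} (hp : p ∈ S) (hpM : p.2 < M)
    (hpI : dyadic (n + e) p.1 < I * 2 ^ e) :
    (hitCount (occGrid (n + e) ((n + e) * 2 ^ (n + e)) (I * 2 ^ e) S) (dyadic (n + e) p.2)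
      (dyadic (n + e) p.1) : ℕ∞) = (southWest S p).encard := by
  have hmem : ∀ q ∈ S, dyadic (n + e) q.1 < I * 2 ^ e → q.2 < M →
      q ∈ S ∩ {p | p.1 < I / 2 ^ n + 1 ∧ p.2 < M} := fun q hq h1 h2 =>
    ⟨hq, (lt_of_dyadic_lt h1).trans (lt_add_one _), h2⟩
  have hpm := hmem p hp hpI hpM
  have hsw : ∀ q ∈ southWest S p, q ∈ S ∩ {p | p.1 < I / 2 ^ n + 1 ∧ p.2 < M} := fun q hq =>
    hmem q hq.1 ((dyadic_mono _ hq.2.1.le).trans_lt hpI) (hq.2.2.trans hpM)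
  rw [coe_hitCount_occGrid hpI]
  have himage : {j' : ℕ | j' < (n + e) * 2 ^ (n + e) ∧ j' < dyadic (n + e) p.2 ∧
      ∃ q ∈ S, dyadic (n + e) q.1 ≤ dyadic (n + e) p.1 ∧ dyadic (n + e) q.2 = j'} =
      (fun q => dyadic (n + e) q.2) '' southWest S p := by
    ext j'
    constructor
    · rintro ⟨-, h2, q, hq, h3, rfl⟩
      -- The columns are strictly ordered, but the time indices satisfy only `≤`. Equal times are
      -- excluded by `injOn_fst`, and the reverse order by strict monotonicity on the resolved
      -- points.
      have hq2 : q.2 < p.2 := (dyadic_mono _).reflect_lt h2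
      have hqm := hmem q hq (h3.trans_lt hpI) (hq2.trans hpM)
      refine ⟨q, ⟨hq, ?_, hq2⟩, rfl⟩
      rcases lt_trichotomy q.1 p.1 with hlt | heq | hgt
      · exact hlt
      · rw [h.injOn_fst hq hp heq] at hq2
        exact absurd hq2 (lt_irrefl _)
      · exact absurd (hR.fst (mem_image_of_mem _ hpm) (mem_image_of_mem _ hqm) hgt) (not_lt.2 h3)
    · rintro ⟨q, hq, rfl⟩
      have hlt := hR.snd (mem_image_of_mem _ (hsw q hq)) (mem_image_of_mem _ hpm) hq.2.2
      refine ⟨hlt.trans ?_, hlt, q, hq.1, dyadic_mono _ hq.2.1.le, rfl⟩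
      exact dyadic_lt_mul_two_pow (h.pos p hp).2.le (hpM.trans_le hR.le)
  rw [himage, InjOn.encard_image]
  intro q hq q' hq' hqq
  exact h.injOn_snd hq.1 hq'.1 (hR.snd.injOn (mem_image_of_mem _ (hsw q hq))
    (mem_image_of_mem _ (hsw q' hq')) hqq)

/-- On a resolving grid, early points make the hit counts large. -/
lemma IsGood.lt_hitCount {S : Set (ℝ × ℝ)} (h : IsGood S) {n e I : ℕ} {M : ℝ}
    (hR : Resolves S (I / 2 ^ n + 1) M (n + e)) {T : Finset (ℝ × ℝ)} {K : ℕ}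
    (hTS : (T : Set (ℝ × ℝ)) ⊆ S) (hc : T.card = K + 2)
    (hT : ∀ p ∈ T, 2 ^ n * p.1 < 1 ∧ p.2 < M) {i j : ℕ} (hi : i < I * 2 ^ e) (hei : 2 ^ e ≤ i)
    (hj : ∀ p ∈ T, dyadic (n + e) p.2 ≤ j) :
    K < hitCount (occGrid (n + e) ((n + e) * 2 ^ (n + e)) (I * 2 ^ e) S) j i := by
  classical
  have hmem : ∀ q ∈ T, q ∈ S ∩ {p | p.1 < I / 2 ^ n + 1 ∧ p.2 < M} := by
    intro q hq
    refine ⟨hTS hq, ?_, (hT q hq).2⟩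
    have h1 : q.1 ≤ 2 ^ n * q.1 :=
      le_mul_of_one_le_left (h.pos q (hTS hq)).1.le (one_le_pow₀ one_le_two)
    have h2 : (0 : ℝ) ≤ I / 2 ^ n := by positivity
    have h3 := (hT q hq).1
    show q.1 < _
    linarith
  have hsub : (((T.image (fun q => dyadic (n + e) q.2)).erase j : Finset ℕ) : Set ℕ) ⊆
      {j' : ℕ | j' < (n + e) * 2 ^ (n + e) ∧ j' < j ∧
        ∃ p ∈ S, dyadic (n + e) p.1 ≤ i ∧ dyadic (n + e) p.2 = j'} := by
    intro j' hj'
    rw [Finset.mem_coe, Finset.mem_erase, Finset.mem_image] at hj'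
    obtain ⟨hne, q, hq, rfl⟩ := hj'
    refine ⟨?_, lt_of_le_of_ne (hj q hq) hne, q, hTS hq, ?_, rfl⟩
    · exact dyadic_lt_mul_two_pow (h.pos q (hTS hq)).2.le ((hT q hq).2.trans_le hR.le)
    · have : ¬ 2 ^ e ≤ dyadic (n + e) q.1 := fun hle =>
        absurd ((one_le_two_pow_mul_iff n e q.1).2 hle) (not_le.2 (hT q hq).1)
      omega
  have hcard : (T.image (fun q => dyadic (n + e) q.2)).card = K + 2 := by
    rw [Finset.card_image_of_injOn, hc]
    intro q hq q' hq' hqq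
    exact h.injOn_snd (hTS hq) (hTS hq') (hR.snd.injOn (mem_image_of_mem _ (hmem q hq))
      (mem_image_of_mem _ (hmem q' hq')) hqq)
  have h1 := encard_le_encard hsub
  rw [encard_coe_eq_coe_finsetCard, ← coe_hitCount_occGrid hi] at h1
  -- The column `j` may contain one of the `K + 2` points and does not count towards its own rank;
  -- at least `K + 1` columns remain.
  have h2 := Finset.pred_card_le_card_erase (s := T.image (fun q => dyadic (n + e) q.2)) (a := j)
  rw [hcard] at h2
  have h1 : _ ≤ _ := Nat.cast_le.1 h1
  omega

/-- The forbidden ranks are bounded by some `K`. Early points below a height `M` force larger ranks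
at or above `M`, both for points and for grid cells, so only the finitely many points below `M`
matter, and a fine grid resolves those. The same early points push every relevant counter beyond `K`
once all columns are used. -/
lemma IsGood.eventually_grid {S : Set (ℝ × ℝ)} (h : IsGood S) (n : ℕ) (A : ℕ → Finset ℕ) (I : ℕ)
    (hA : A 0 = ∅) :
    ∀ᶠ e in atTop,
      (Violates (fun i => A (i / 2 ^ e)) (fun _ => 0)
        (occGrid (n + e) ((n + e) * 2 ^ (n + e)) (I * 2 ^ e) S) ↔
          (recordSet S ∩ gridSet n A I).Nonempty) ∧
      ∀ i : Fin (I * 2 ^ e), ∀ k ∈ A (i / 2 ^ e),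
        k < hitCount (occGrid (n + e) ((n + e) * 2 ^ (n + e)) (I * 2 ^ e) S)
          ((n + e) * 2 ^ (n + e)) i := by
  obtain ⟨K, hK⟩ : ∃ K, ∀ i < I, ∀ k ∈ A i, k ≤ K := by
    refine ⟨(Finset.range I).sup (fun i => (A i).sup id), fun i hi k hk => ?_⟩
    exact (Finset.le_sup (f := id) hk).trans
      (Finset.le_sup (f := fun i => (A i).sup id) (Finset.mem_range.2 hi))
  obtain ⟨T, M, hTS, hc, hT⟩ := h.exists_early n (K + 2)
  filter_upwards [(tendsto_add_atTop_nat n |>.congr fun e => add_comm e n).eventually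
    (h.eventually_resolves (I / 2 ^ n + 1) M)] with e hR
  -- As `A 0` is empty, a forbidden rank can occur only after the first coarse cell, when all points
  -- of `T` have already appeared.
  have hdiv : ∀ {i k : ℕ}, k ∈ A (i / 2 ^ e) → 2 ^ e ≤ i := by
    intro i k hk
    by_contra hlt
    rw [Nat.div_eq_of_lt (not_le.1 hlt), hA] at hk
    simp at hk
  have hle : ∀ {i k : ℕ}, i < I * 2 ^ e → k ∈ A (i / 2 ^ e) → k ≤ K := fun hi hk =>
    hK _ ((Nat.div_lt_iff_lt_mul (by positivity)).2 hi) _ hk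
  refine ⟨⟨?_, ?_⟩, ?_⟩
  · rintro ⟨j, i, hij, hk⟩
    simp only [occGrid, decide_eq_true_eq] at hij
    obtain ⟨p, hp, hpi, hpj⟩ := hij
    have hpI : dyadic (n + e) p.1 < I * 2 ^ e := by rw [hpi]; exact i.2
    rw [zero_add] at hk
    have hpM : p.2 < M := by
      by_contra hM
      have := h.lt_hitCount hR hTS hc hT i.2 (hdiv hk) (j := j)
        (fun q hq => by
          rw [← hpj]
          exact dyadic_mono _ ((hT q hq).2.le.trans (not_lt.1 hM)))
      exact absurd (hle i.2 hk) (not_le.2 this)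
    have hcount := h.coe_hitCount_eq hR hp hpM hpI
    rw [hpi, hpj] at hcount
    refine ⟨(_, p.1), ⟨p.2, hp, hcount.symm⟩, ?_⟩
    rw [gridSet_refine n e]
    simp only [gridSet, mem_ofPred_eq]
    rw [hpi]
    exact ⟨i.2, hk⟩
  · rintro ⟨⟨k, t⟩, ⟨x, hx, hk⟩, hg⟩
    rw [gridSet_refine n e] at hg
    obtain ⟨hI, hkA⟩ := hg
    simp only at hx hk hI hkA
    have hxM : x < M := by
      by_contra hM
      have := card_le_encard_southWest hTS hT (a := (t, x))
        ((one_le_two_pow_mul_iff n e t).2 (hdiv hkA)) (not_lt.1 hM)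
      rw [hk, hc] at this
      have h2 : K + 2 ≤ k := by exact_mod_cast this
      have := hle hI hkA
      omega
    have hcount := h.coe_hitCount_eq hR hx hxM hI
    rw [hk] at hcount
    have hcount := Nat.cast_inj.1 hcount
    refine ⟨⟨dyadic (n + e) x, dyadic_lt_mul_two_pow (h.pos _ hx).2.le (hxM.trans_le hR.le)⟩,
      ⟨_, hI⟩, ?_, ?_⟩
    · simp only [occGrid, decide_eq_true_eq]
      exact ⟨(t, x), hx, rfl, rfl⟩
    · simp only at hcount ⊢
      rw [zero_add, hcount]
      exact hkA
  · intro i k hk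
    refine (hle i.2 hk).trans_lt (h.lt_hitCount hR hTS hc hT i.2 (hdiv hk) fun q hq => ?_)
    exact (dyadic_lt_mul_two_pow (h.pos q (hTS hq)).2.le ((hT q hq).2.trans_le hR.le)).le

open Classical in
lemma IsGood.eventually_gridValue {S : Set (ℝ × ℝ)} (h : IsGood S) (n : ℕ) (A : ℕ → Finset ℕ)
    (I : ℕ) (hA : A 0 = ∅) (r : ℕ → ℝ) :
    ∀ᶠ e in atTop, gridValue (r e) (fun i => A (i / 2 ^ e)) (fun _ => 0)
        (occGrid (n + e) ((n + e) * 2 ^ (n + e)) (I * 2 ^ e) S) =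
      if recordSet S ∩ gridSet n A I = ∅ then 1 else 0 := by
  filter_upwards [h.eventually_grid n A I hA] with e he
  rw [gridValue, he.1]
  by_cases hv : recordSet S ∩ gridSet n A I = ∅
  · rw [if_neg (by rw [hv]; simp), if_pos hv, avoidProb]
    refine Finset.prod_eq_one fun i _ => ?_
    rw [Finset.filter_false_of_mem, Finset.card_empty, pow_zero]
    intro k hk
    have := he.2 i k hk
    omega
  · rw [if_pos (nonempty_iff_ne_empty.2 hv), if_neg hv]

/-! ### Corners -/

/-- An infinite set of reals with finite initial segments has elements of every rank. -/
lemma exists_encard_inter_Iio_eq {L : Set ℝ} (hinf : L.Infinite) (hfin : ∀ a, (L ∩ Iio a).Finite)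
    (j : ℕ) : ∃ c ∈ L, (L ∩ Iio c).encard = j := by
  have hmin : ∀ L' ⊆ L, L'.Nonempty → ∃ c ∈ L', ∀ d ∈ L', c ≤ d := by
    rintro L' hL' ⟨a, ha⟩
    have hf : (L' ∩ Iio (a + 1)).Finite := (hfin (a + 1)).subset (inter_subset_inter_left _ hL')
    obtain ⟨c, ⟨hc, hca⟩, hcm⟩ := exists_min_image _ id hf ⟨a, ha, by simp⟩
    refine ⟨c, hc, fun d hd => ?_⟩
    by_cases hda : d < a + 1
    · exact hcm d ⟨hd, hda⟩
    · exact (le_of_lt hca).trans (not_lt.1 hda)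
  induction j with
  | zero =>
    obtain ⟨c, hc, hcm⟩ := hmin L subset_rfl hinf.nonempty
    refine ⟨c, hc, ?_⟩
    rw [Nat.cast_zero, encard_eq_zero, eq_empty_iff_forall_notMem]
    rintro d ⟨hd, hdc⟩
    exact absurd (hcm d hd) (not_le.2 hdc)
  | succ j ih =>
    obtain ⟨c, hc, hcj⟩ := ih
    have hne : (L ∩ Ioi c).Nonempty := by
      by_contra hemp
      refine hinf ((hfin (c + 1)).subset fun d hd => ⟨hd, ?_⟩)
      have : ¬ c < d := fun hcd => hemp ⟨d, hd, hcd⟩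
      simp only [mem_Iio]
      linarith
    obtain ⟨d, ⟨hd, hcd⟩, hdm⟩ := hmin _ inter_subset_left hne
    refine ⟨d, hd, ?_⟩
    have : L ∩ Iio d = insert c (L ∩ Iio c) := by
      ext a
      simp only [mem_inter_iff, mem_Iio, mem_insert_iff]
      constructor
      · rintro ⟨ha, had⟩
        rcases lt_trichotomy a c with h | h | h
        · exact Or.inr ⟨ha, h⟩
        · exact Or.inl h
        · exact absurd (hdm a ⟨ha, h⟩) (not_le.2 had)
      · rintro (rfl | ⟨ha, hac⟩)
        · exact ⟨hc, hcd⟩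
        · exact ⟨ha, hac.trans hcd⟩
    rw [this, encard_insert_of_notMem (by simp), hcj]
    norm_cast

lemma fst_image_kRecords (S : Set (ℝ × ℝ)) (k : ℕ) :
    Prod.fst '' kRecords S (k + 1) = {t | (k, t) ∈ recordSet S} := by
  have key : ∀ a : ℝ × ℝ, (southWest S a).encard + 1 = ((k + 1 : ℕ) : ℕ∞) ↔
      (southWest S a).encard = k := fun a => by
    push_cast
    exact (ENat.add_left_injective_of_ne_top ENat.one_ne_top).eq_iff
  ext t
  constructor
  · rintro ⟨⟨t, x⟩, ⟨h1, h2⟩, rfl⟩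
    exact ⟨x, h1, (key _).1 h2⟩
  · rintro ⟨x, h1, h2⟩
    exact ⟨(t, x), ⟨h1, (key _).2 h2⟩, rfl⟩

/-- Below a corner that is not a record lies a point on the same vertical line, whose south-west
region is contained in that of the corner; so its rank is at most `k - 1`. Conversely, go up the
vertical line from a point of rank `r < k` to the height of that point on the left which has exactly
`k - 1` left points below it. This is the number required of a corner of order `k + 1`. -/
lemma IsGood.fst_image_kCorners {S : Set (ℝ × ℝ)} (h : IsGood S) (k : ℕ) :
    Prod.fst '' kCorners S (k + 1) = {t | ∃ r ≤ k, (r, t) ∈ recordSet S} := by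
  rw [kCorners, image_union, fst_image_kRecords]
  ext t
  constructor
  · rintro (ht | ⟨a, ⟨-, hcard, -, d, hd, hd1, hd2⟩, rfl⟩)
    · exact ⟨k, le_rfl, ht⟩
    · have hsub : southWest S d ⊆ southWest S a := fun b hb =>
        ⟨hb.1, hb.2.1.trans_eq hd1, hb.2.2.trans hd2⟩
      have hfin : (southWest S a).encard ≠ ⊤ := by
        intro htop
        rw [htop, top_add] at hcard
        exact ENat.top_ne_natCast _ hcard
      obtain ⟨l, hl⟩ := ENat.ne_top_iff_exists.1 hfin
      have hle := encard_le_encard hsub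
      rw [← hl] at hle hcard
      have hfin' : (southWest S d).encard ≠ ⊤ := ne_top_of_le_ne_top (by simp) hle
      obtain ⟨r, hr⟩ := ENat.ne_top_iff_exists.1 hfin'
      rw [← hr] at hle
      have h1 : r ≤ l := by exact_mod_cast hle
      have h2 : l + 2 = k + 1 := by exact_mod_cast hcard
      refine ⟨r, by omega, d.2, ?_, ?_⟩
      · rw [← hd1]; exact hd
      · rw [← hd1]; exact hr.symm
  · rintro ⟨r, hrk, x, hx, hr⟩
    rcases hrk.eq_or_lt with rfl | hlt
    · exact Or.inl ⟨x, hx, hr⟩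
    right
    simp only at hx hr
    obtain ⟨j, rfl⟩ : ∃ j, k = j + 1 := ⟨k - 1, by omega⟩
    have ht := (h.pos _ hx).1
    have hinjon : InjOn Prod.snd (S ∩ {b | b.1 < t}) := h.injOn_snd.mono inter_subset_left
    have hinf : (Prod.snd '' (S ∩ {b | b.1 < t})).Infinite := by
      refine Infinite.image hinjon ?_
      obtain ⟨n, hn⟩ := (eventually_one_le_two_pow_mul ht).exists
      refine (h.infinite n).mono (inter_subset_inter_right _ fun b hb => ?_)
      have hb : (2 : ℝ) ^ n * b.1 < 1 := hb
      exact (mul_lt_mul_iff_right₀ (by positivity)).1 (hb.trans_le hn)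
    have hseg : ∀ a, Prod.snd '' (S ∩ {b | b.1 < t}) ∩ Iio a =
        Prod.snd '' (southWest S (t, a)) := by
      intro a
      ext y
      constructor
      · rintro ⟨⟨b, ⟨hb, hbt⟩, rfl⟩, hy⟩
        exact ⟨b, ⟨hb, hbt, hy⟩, rfl⟩
      · rintro ⟨b, ⟨hb, hbt, hy⟩, rfl⟩
        exact ⟨⟨b, ⟨hb, hbt⟩, rfl⟩, hy⟩
    obtain ⟨_, ⟨c, ⟨hcS, hct⟩, rfl⟩, hcj⟩ := exists_encard_inter_Iio_eq hinf (fun a => by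
      rw [hseg]
      exact ((h.finite_real t a).subset fun b hb => hb).image _) j
    have hsw : southWest S (t, c.2) ⊆ S ∩ {b | b.1 < t} := fun b hb => ⟨hb.1, hb.2.1⟩
    rw [hseg, InjOn.encard_image (hinjon.mono hsw)] at hcj
    have hct : c.1 < t := hct
    -- Otherwise `c` and the `j` left points below it would all be south-west of `(t, x)`,
    -- contradicting `r ≤ j`.
    have hxc : x < c.2 := by
      by_contra hle
      have hne : c.2 ≠ x := by
        intro heq
        have := h.injOn_snd hcS hx heq
        rw [this] at hct
        exact lt_irrefl _ hct
      have hcx : c.2 < x := lt_of_le_of_ne (not_lt.1 hle) hne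
      have hsub : insert c (southWest S (t, c.2)) ⊆ southWest S (t, x) := by
        rintro b (rfl | hb)
        · exact ⟨hcS, hct, hcx⟩
        · exact ⟨hb.1, hb.2.1, hb.2.2.trans hcx⟩
      have hcard := encard_le_encard hsub
      rw [encard_insert_of_notMem (fun hc => lt_irrefl _ hc.2.2), hcj, hr] at hcard
      have : j + 1 ≤ r := by exact_mod_cast hcard
      omega
    refine ⟨(t, c.2), ⟨fun hmem => ?_, ?_, ⟨c, hcS, hct, rfl⟩, ⟨(t, x), hx, rfl, hxc⟩⟩, rfl⟩
    · have := h.injOn_fst hmem hx rfl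
      exact hxc.ne' (Prod.ext_iff.1 this).2
    · rw [hcj]
      norm_cast

/-! ### Poisson laws and Poisson processes -/

lemma poissonLaw_of_ne_top {r : ℝ≥0∞} (hr : r ≠ ∞) (s : Set ℕ∞) :
    poissonLaw r s = poissonMeasure r.toNNReal ((fun n : ℕ => (n : ℕ∞)) ⁻¹' s) := by
  rw [poissonLaw, if_neg hr, Measure.map_apply (measurable_of_countable _) (.of_discrete)]

lemma poissonLaw_singleton_natCast {r : ℝ≥0∞} (hr : r ≠ ∞) (n : ℕ) :
    poissonLaw r {(n : ℕ∞)} =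
      ENNReal.ofReal (Real.exp (-r.toReal) * r.toReal ^ n / n.factorial) := by
  have : (fun n : ℕ => (n : ℕ∞)) ⁻¹' {(n : ℕ∞)} = {n} := by ext; simp
  rw [poissonLaw_of_ne_top hr, this, poissonMeasure_singleton]
  rfl

instance (r : ℝ≥0∞) : IsProbabilityMeasure (poissonLaw r) := by
  by_cases hr : r = ∞
  · rw [poissonLaw, if_pos hr]; infer_instance
  · refine ⟨?_⟩
    rw [poissonLaw_of_ne_top hr]
    simp

lemma poissonLaw_singleton_zero {r : ℝ≥0∞} (hr : r ≠ ∞) :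
    poissonLaw r {0} = ENNReal.ofReal (Real.exp (-r.toReal)) := by
  have := poissonLaw_singleton_natCast hr 0
  simpa using this

lemma poissonLaw_singleton_top {r : ℝ≥0∞} (hr : r ≠ ∞) : poissonLaw r {⊤} = 0 := by
  have : (fun n : ℕ => (n : ℕ∞)) ⁻¹' {⊤} = ∅ := by ext; simp
  rw [poissonLaw_of_ne_top hr, this, measure_empty]

/-- From `exp (-r) ≥ 1 - r` one gets `1 - (1 + r) * exp (-r) ≤ r ^ 2`. The quadratic order is what
rules out coinciding coordinates. -/
lemma poissonLaw_two_le {r : ℝ≥0∞} (hr : r ≠ ∞) : poissonLaw r {n | 2 ≤ n} ≤ r ^ 2 := by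
  have hcompl : {n : ℕ∞ | 2 ≤ n} = ({0} ∪ {1})ᶜ := by
    ext n
    induction n using ENat.recTopCoe with
    | top => simp
    | coe n =>
      simp only [mem_ofPred_eq, mem_compl_iff, mem_union, mem_singleton_iff]
      norm_cast
      omega
  have h0 := poissonLaw_singleton_natCast hr 0
  have h1 := poissonLaw_singleton_natCast hr 1
  simp only [Nat.cast_zero, Nat.cast_one, pow_zero, mul_one, Nat.factorial_zero, div_one, pow_one,
    Nat.factorial_one] at h0 h1
  have hx : (0 : ℝ) ≤ r.toReal := ENNReal.toReal_nonneg
  rw [hcompl, prob_compl_eq_one_sub .of_discrete, measure_union (by simp) .of_discrete, h0, h1,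
    ← ENNReal.ofReal_add (by positivity) (by positivity), ← ENNReal.ofReal_one,
    ← ENNReal.ofReal_sub _ (by positivity), ← ENNReal.ofReal_toReal hr,
    ← ENNReal.ofReal_pow (by positivity)]
  refine ENNReal.ofReal_le_ofReal ?_
  rw [ENNReal.toReal_ofReal hx]
  have := Real.add_one_le_exp (-r.toReal)
  nlinarith

section General

variable {Ω E E' : Type*} [MeasurableSpace Ω] [MeasurableSpace E] [MeasurableSpace E']
  {μ : Measure Ω} {X : Ω → Set E} {ν : Measure E}

lemma IsPoissonProcess.measure_encard_mem (h : IsPoissonProcess X ν μ) {B : Set E}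
    (hB : MeasurableSet B) (s : Set ℕ∞) :
    μ {ω | (X ω ∩ B).encard ∈ s} = poissonLaw (ν B) s := by
  have hl := h.hasLaw_encard B hB
  rw [← hl.map_eq, Measure.map_apply_of_aemeasurable hl.aemeasurable .of_discrete]
  rfl

lemma IsPoissonProcess.measure_void (h : IsPoissonProcess X ν μ) {B : Set E}
    (hB : MeasurableSet B) (hν : ν B ≠ ∞) :
    μ {ω | X ω ∩ B = ∅} = ENNReal.ofReal (Real.exp (-(ν B).toReal)) := by
  rw [← poissonLaw_singleton_zero hν, ← h.measure_encard_mem hB]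
  simp

lemma IsPoissonProcess.ae_encard_mem (h : IsPoissonProcess X ν μ)
    {B : Set E} (hB : MeasurableSet B) {s : Set ℕ∞} (hs : poissonLaw (ν B) sᶜ = 0) :
    ∀ᵐ ω ∂μ, (X ω ∩ B).encard ∈ s := by
  rw [ae_iff, ← hs, ← h.measure_encard_mem hB]
  rfl

/-- Poisson processes are stable under maps of the points which are injective on almost every
realization, and under restrictions and projections; `ψ` stands for taking preimages. -/
lemma IsPoissonProcess.of_encard_eq (h : IsPoissonProcess X ν μ) {Y : Ω → Set E'}
    {ν' : Measure E'} (ψ : Set E' → Set E) (hψ : ∀ B, MeasurableSet B → MeasurableSet (ψ B))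
    (hdisj : ∀ B C, Disjoint B C → Disjoint (ψ B) (ψ C))
    (hν : ∀ B, MeasurableSet B → ν (ψ B) = ν' B)
    (hY : ∀ᵐ ω ∂μ, ∀ B, MeasurableSet B → (Y ω ∩ B).encard = (X ω ∩ ψ B).encard) :
    IsPoissonProcess Y ν' μ where
  aemeasurable_counts := by
    have hm : Measurable (fun (c : {B : Set E // MeasurableSet B} → ℕ∞)
        (B : {B : Set E' // MeasurableSet B}) => c ⟨ψ B.1, hψ _ B.2⟩) :=
      measurable_pi_lambda _ fun B => measurable_pi_apply _
    refine (hm.comp_aemeasurable h.aemeasurable_counts).congr ?_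
    filter_upwards [hY] with ω hω
    funext B
    exact (hω B.1 B.2).symm
  hasLaw_encard B hB := by
    rw [← hν B hB]
    refine (h.hasLaw_encard (ψ B) (hψ B hB)).congr ?_
    filter_upwards [hY] with ω hω using hω B hB
  iIndepFun_encard n B hB hd := by
    refine (h.iIndepFun_encard n (fun i => ψ (B i)) (fun i => hψ _ (hB i))
      fun i j hij => hdisj _ _ (hd hij)).congr fun i => ?_
    filter_upwards [hY] with ω hω using (hω _ (hB i)).symm

lemma IsPoissonProcess.congr (h : IsPoissonProcess X ν μ) {Y : Ω → Set E}
    (hY : ∀ᵐ ω ∂μ, Y ω = X ω) : IsPoissonProcess Y ν μ := by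
  refine h.of_encard_eq id (fun _ h => h) (fun _ _ h => h) (fun _ _ => rfl) ?_
  filter_upwards [hY] with ω hω B _
  rw [hω, id]

end General

/-- Counts are measurable functions of the configuration, so their laws and their independence
depend only on the law of the configuration. -/
lemma IsPoissonProcess.of_map_eq {Ω : Type*} [MeasurableSpace Ω] {μ : Measure Ω}
    [IsProbabilityMeasure μ] {X Y : Ω → Conf} {ν : Measure (ℕ × ℝ)} (hX : Measurable X)
    (hY : Measurable Y) (hXY : μ.map X = μ.map Y)
    (h : IsPoissonProcess (fun ω => (X ω).1) ν μ) : IsPoissonProcess (fun ω => (Y ω).1) ν μ := by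
  have hmeas : ∀ B : Set (ℕ × ℝ), MeasurableSet B →
      Measurable (fun ω => ((Y ω).1 ∩ B).encard) := fun B hB => (measurable_encard_conf hB).comp hY
  have hmeasX : ∀ B : Set (ℕ × ℝ), MeasurableSet B →
      Measurable (fun ω => ((X ω).1 ∩ B).encard) := fun B hB => (measurable_encard_conf hB).comp hX
  have hmap : ∀ B : Set (ℕ × ℝ), MeasurableSet B →
      μ.map (fun ω => ((Y ω).1 ∩ B).encard) = μ.map (fun ω => ((X ω).1 ∩ B).encard) := by
    intro B hB
    have h1 := Measure.map_map (μ := μ) (measurable_encard_conf hB) hY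
    have h2 := Measure.map_map (μ := μ) (measurable_encard_conf hB) hX
    rw [hXY] at h2
    exact h1.symm.trans h2
  refine ⟨(measurable_counts_conf.comp hY).aemeasurable,
    fun B hB => ⟨(hmeas B hB).aemeasurable, ?_⟩,
    fun n B hB hd => ?_⟩
  · rw [hmap B hB]
    exact (h.hasLaw_encard B hB).map_eq
  · have hindX := h.iIndepFun_encard n B hB hd
    rw [iIndepFun_iff_map_fun_eq_pi_map fun i => (hmeasX _ (hB i)).aemeasurable] at hindX
    rw [iIndepFun_iff_map_fun_eq_pi_map fun i => (hmeas _ (hB i)).aemeasurable]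
    have hm : Measurable (fun (S : Conf) (i : Fin n) => (S.1 ∩ B i).encard) :=
      measurable_pi_lambda _ fun i => measurable_encard_conf (hB i)
    have h1 := Measure.map_map (μ := μ) hm hY
    have h2 := Measure.map_map (μ := μ) hm hX
    rw [hXY] at h2
    simp_rw [fun i => hmap (B i) (hB i)]
    exact (h1.symm.trans h2).trans hindX

/-! ### The planar Poisson process -/

lemma quadrantMeasure_prod (B C : Set ℝ) :
    quadrantMeasure (B ×ˢ C) =
      volume.restrict (Ioi 0) B * volume.restrict (Ioi 0) C := by
  rw [quadrantMeasure, Measure.volume_eq_prod, ← Measure.prod_restrict, Measure.prod_prod]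

lemma measurableSet_dyadic_eq (m i : ℕ) : MeasurableSet {t : ℝ | dyadic m t = i} :=
  measurable_dyadic m (measurableSet_singleton i)

lemma setOf_floor_mul_eq_inter {c : ℝ} (hc : 0 < c) (i : ℕ) :
    {t : ℝ | ⌊c * t⌋₊ = i} ∩ Ici 0 = Ico ((i : ℝ) / c) (((i : ℝ) + 1) / c) := by
  ext t
  simp only [mem_inter_iff, mem_ofPred_eq, mem_Ici, mem_Ico]
  rw [div_le_iff₀ hc, lt_div_iff₀ hc, mul_comm t]
  constructor
  · rintro ⟨h, h0⟩
    exact (Nat.floor_eq_iff (by positivity)).1 h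
  · intro h
    have h0 : 0 ≤ c * t := (Nat.cast_nonneg i).trans h.1
    exact ⟨(Nat.floor_eq_iff h0).2 h, nonneg_of_mul_nonneg_right h0 hc⟩

lemma measurableSet_floor_mul_eq (c : ℝ) (i : ℕ) : MeasurableSet {t : ℝ | ⌊c * t⌋₊ = i} :=
  (Nat.measurable_floor.comp (measurable_const_mul c)) (measurableSet_singleton i)

lemma volume_floor_mul_eq {c : ℝ} (hc : 0 < c) (i : ℕ) :
    volume.restrict (Ioi (0 : ℝ)) {t | ⌊c * t⌋₊ = i} = ENNReal.ofReal (1 / c) := by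
  rw [restrict_Ioi_eq_restrict_Ici, Measure.restrict_apply (measurableSet_floor_mul_eq c i),
    setOf_floor_mul_eq_inter hc, Real.volume_Ico, ← sub_div, add_sub_cancel_left]

lemma volume_dyadic_cell (m i : ℕ) :
    volume.restrict (Ioi (0 : ℝ)) {t | dyadic m t = i} = ENNReal.ofReal ((1 / 2) ^ m) := by
  rw [one_div_pow]
  exact volume_floor_mul_eq (by positivity) i

/-- The cell of level `m` with indices `i` and `j`. -/
def cell (m i j : ℕ) : Set (ℝ × ℝ) := {p | dyadic m p.1 = i ∧ dyadic m p.2 = j}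

lemma measurableSet_cell (m i j : ℕ) : MeasurableSet (cell m i j) :=
  (((measurable_dyadic m).comp measurable_fst) (measurableSet_singleton i)).inter
    (((measurable_dyadic m).comp measurable_snd) (measurableSet_singleton j))

lemma quadrantMeasure_cell (m i j : ℕ) :
    quadrantMeasure (cell m i j) = ENNReal.ofReal ((1 / 4) ^ m) := by
  have : cell m i j = {t | dyadic m t = i} ×ˢ {t | dyadic m t = j} := rfl
  rw [this, quadrantMeasure_prod, volume_dyadic_cell, volume_dyadic_cell,
    ← ENNReal.ofReal_mul (by positivity), ← mul_pow]
  norm_num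

section Planar

variable {Ω : Type*} [MeasurableSpace Ω] {μ : Measure Ω} {P : Ω → Set (ℝ × ℝ)}

lemma IsPoissonProcess.swap (hP : IsPoissonProcess P quadrantMeasure μ) :
    IsPoissonProcess (fun ω => Prod.swap '' P ω) quadrantMeasure μ := by
  refine hP.of_encard_eq (fun B => Prod.swap ⁻¹' B) (fun B hB => measurable_swap hB)
    (fun B C h => h.preimage _) (fun B hB => ?_) (Eventually.of_forall fun ω B _ => ?_)
  · have h1 : quadrantMeasure.map Prod.swap = quadrantMeasure := by
      rw [quadrantMeasure, Measure.volume_eq_prod, ← Measure.prod_restrict, Measure.prod_swap]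
    rw [← Measure.map_apply measurable_swap hB, h1]
  · rw [← image_inter_preimage, Prod.swap_injective.encard_image]

lemma IsPoissonProcess.ae_pos (hP : IsPoissonProcess P quadrantMeasure μ) :
    ∀ᵐ ω ∂μ, ∀ p ∈ P ω, 0 < p.1 ∧ 0 < p.2 := by
  have hB : MeasurableSet (Ioi (0 : ℝ) ×ˢ Ioi (0 : ℝ))ᶜ :=
    (measurableSet_Ioi.prod measurableSet_Ioi).compl
  have h0 : quadrantMeasure (Ioi (0 : ℝ) ×ˢ Ioi (0 : ℝ))ᶜ = 0 := by
    rw [quadrantMeasure, Measure.restrict_apply hB, compl_inter_self, measure_empty]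
  have := hP.ae_encard_mem hB (s := {0}) (by
    rw [h0, prob_compl_eq_zero_iff .of_discrete, poissonLaw_singleton_zero (by simp)]
    simp)
  filter_upwards [this] with ω hω p hp
  rw [mem_singleton_iff, encard_eq_zero] at hω
  by_contra hn
  exact (eq_empty_iff_forall_notMem.1 hω) p ⟨hp, hn⟩

lemma IsPoissonProcess.ae_finite (hP : IsPoissonProcess P quadrantMeasure μ) :
    ∀ᵐ ω ∂μ, ∀ n : ℕ, (P ω ∩ {p | p.1 < n ∧ p.2 < n}).Finite := by
  rw [ae_all_iff]
  intro n
  have hB : MeasurableSet {p : ℝ × ℝ | p.1 < n ∧ p.2 < n} :=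
    (measurableSet_Iio (a := (n : ℝ))).prod (measurableSet_Iio (a := (n : ℝ)))
  have hfin : quadrantMeasure {p : ℝ × ℝ | p.1 < n ∧ p.2 < n} ≠ ∞ := by
    have : {p : ℝ × ℝ | p.1 < n ∧ p.2 < n} = Iio (n : ℝ) ×ˢ Iio (n : ℝ) := rfl
    rw [this, quadrantMeasure_prod, Measure.restrict_apply measurableSet_Iio, Iio_inter_Ioi,
      Real.volume_Ioo]
    exact ENNReal.mul_ne_top ENNReal.ofReal_ne_top ENNReal.ofReal_ne_top
  have := hP.ae_encard_mem hB (s := {⊤}ᶜ) (by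
    rw [compl_compl, poissonLaw_singleton_top hfin])
  filter_upwards [this] with ω hω
  exact encard_ne_top_iff.1 hω

lemma IsPoissonProcess.ae_infinite (hP : IsPoissonProcess P quadrantMeasure μ) :
    ∀ᵐ ω ∂μ, ∀ n : ℕ, (P ω ∩ {p | 2 ^ n * p.1 < 1}).Infinite := by
  rw [ae_all_iff]
  intro n
  have hB : MeasurableSet {p : ℝ × ℝ | 2 ^ n * p.1 < 1} :=
    measurableSet_lt (measurable_fst.const_mul _) measurable_const
  have htop : quadrantMeasure {p : ℝ × ℝ | 2 ^ n * p.1 < 1} = ∞ := by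
    have : {p : ℝ × ℝ | 2 ^ n * p.1 < 1} = Iio ((1 : ℝ) / 2 ^ n) ×ˢ univ := by
      ext p
      simp only [mem_ofPred_eq, mem_prod, mem_Iio, mem_univ, and_true]
      rw [lt_div_iff₀ (by positivity), mul_comm]
    rw [this, quadrantMeasure_prod, Measure.restrict_apply measurableSet_Iio, Iio_inter_Ioi,
      Real.volume_Ioo, Measure.restrict_apply_univ, Real.volume_Ioi, ENNReal.mul_top]
    simp
  have := hP.ae_encard_mem hB (s := {⊤}) (by
    rw [htop, poissonLaw, if_pos rfl, Measure.dirac_apply]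
    simp)
  filter_upwards [this] with ω hω
  exact encard_eq_top_iff.1 hω

/-- Two points below height `N` with equal times share a strip of width `2⁻ᵐ`. Such a strip contains
two points with probability at most `(2⁻ᵐ * N) ^ 2`, and `(N + 1) * 2 ^ m` strips suffice, so the
total probability is `O(2⁻ᵐ)`. -/
lemma IsPoissonProcess.ae_injOn_fst (hP : IsPoissonProcess P quadrantMeasure μ) :
    ∀ᵐ ω ∂μ, InjOn Prod.fst (P ω) := by
  have key : ∀ N : ℕ, ∀ᵐ ω ∂μ, InjOn Prod.fst (P ω ∩ {p | p.1 < N ∧ p.2 < N}) := by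
    intro N
    have hstrip : ∀ m i, quadrantMeasure ({t | dyadic m t = i} ×ˢ Iio (N : ℝ)) =
        ENNReal.ofReal ((1 / 2) ^ m * N) := by
      intro m i
      rw [quadrantMeasure_prod, volume_dyadic_cell, Measure.restrict_apply measurableSet_Iio,
        Iio_inter_Ioi, Real.volume_Ioo, sub_zero, ← ENNReal.ofReal_mul (by positivity)]
    have hbound : ∀ m : ℕ, μ {ω | ¬ InjOn Prod.fst (P ω ∩ {p | p.1 < N ∧ p.2 < N})} ≤
        ENNReal.ofReal ((N + 1) * N ^ 2 * (1 / 2) ^ m) := by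
      intro m
      have hsub : {ω | ¬ InjOn Prod.fst (P ω ∩ {p | p.1 < N ∧ p.2 < N})} ⊆
          ⋃ i ∈ Finset.range ((N + 1) * 2 ^ m),
            {ω | (P ω ∩ ({t | dyadic m t = i} ×ˢ Iio (N : ℝ))).encard ∈ {n : ℕ∞ | 2 ≤ n}} := by
        intro ω hω
        simp only [InjOn, mem_ofPred_eq, not_forall] at hω
        obtain ⟨p, ⟨hp, hp1, hp2⟩, q, ⟨hq, hq1, hq2⟩, hpq, hne⟩ := hω
        have hi : dyadic m p.1 < (N + 1) * 2 ^ m := by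
          refine (dyadic_mono m (le_of_lt hp1)).trans_lt ?_
          rw [dyadic, Nat.floor_lt (by positivity)]
          push_cast
          rw [mul_comm]
          exact mul_lt_mul_of_pos_right (lt_add_one _) (by positivity)
        refine mem_iUnion₂.2 ⟨dyadic m p.1, Finset.mem_range.2 hi, ?_⟩
        have hsub2 : {p, q} ⊆ P ω ∩ ({t | dyadic m t = dyadic m p.1} ×ˢ Iio (N : ℝ)) := by
          rintro _ (rfl | rfl)
          · exact ⟨hp, rfl, hp2⟩
          · exact ⟨hq, by simp only [mem_ofPred_eq, hpq], hq2⟩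
        have := encard_le_encard hsub2
        rwa [encard_pair hne] at this
      refine (measure_mono hsub).trans ((measure_biUnion_finset_le _ _).trans ?_)
      calc ∑ i ∈ Finset.range ((N + 1) * 2 ^ m),
            μ {ω | (P ω ∩ ({t | dyadic m t = i} ×ˢ Iio (N : ℝ))).encard ∈ {n : ℕ∞ | 2 ≤ n}}
          ≤ ∑ i ∈ Finset.range ((N + 1) * 2 ^ m), ENNReal.ofReal (((1 / 2) ^ m * N) ^ 2) := by
            refine Finset.sum_le_sum fun i _ => ?_
            rw [hP.measure_encard_mem
              ((measurableSet_dyadic_eq m i).prod measurableSet_Iio), hstrip,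
              ENNReal.ofReal_pow (by positivity)]
            exact poissonLaw_two_le ENNReal.ofReal_ne_top
        _ = ENNReal.ofReal ((N + 1) * N ^ 2 * (1 / 2) ^ m) := by
            rw [Finset.sum_const, Finset.card_range, nsmul_eq_mul, ← ENNReal.ofReal_natCast,
              ← ENNReal.ofReal_mul (by positivity)]
            congr 1
            push_cast
            have : (2 : ℝ) ^ m * (1 / 2) ^ m = 1 := by rw [← mul_pow]; norm_num
            linear_combination ((N : ℝ) + 1) * N ^ 2 * (1 / 2) ^ m * this
    have hlim : Tendsto (fun m : ℕ => ENNReal.ofReal ((N + 1) * N ^ 2 * (1 / 2) ^ m)) atTop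
        (𝓝 0) := by
      rw [← ENNReal.ofReal_zero]
      refine ENNReal.tendsto_ofReal ?_
      have := (tendsto_pow_atTop_nhds_zero_of_lt_one (r := (1 / 2 : ℝ)) (by norm_num)
        (by norm_num)).const_mul (((N : ℝ) + 1) * N ^ 2)
      rwa [mul_zero] at this
    rw [ae_iff]
    exact le_antisymm (ge_of_tendsto' hlim hbound) bot_le
  filter_upwards [ae_all_iff.2 key] with ω hω p hp q hq hpq
  obtain ⟨N, hN⟩ := exists_nat_gt (max (max p.1 p.2) (max q.1 q.2))
  simp only [max_lt_iff] at hN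
  exact hω N ⟨hp, hN.1⟩ ⟨hq, hN.2⟩ hpq

lemma IsPoissonProcess.ae_isGood (hP : IsPoissonProcess P quadrantMeasure μ) :
    ∀ᵐ ω ∂μ, IsGood (P ω) := by
  filter_upwards [hP.ae_pos, hP.ae_finite, hP.ae_infinite, hP.ae_injOn_fst,
    hP.swap.ae_injOn_fst] with ω h1 h2 h3 h4 h5
  refine ⟨h1, h2, h3, h4, fun p hp q hq hpq => ?_⟩
  exact Prod.swap_injective (h5 (mem_image_of_mem _ hp) (mem_image_of_mem _ hq) hpq)

end Planar

/-! ### The labelled process -/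

lemma measurable_label : Measurable (fun p : ℝ × ℝ => (⌊p.1 * p.2⌋₊, p.1)) :=
  (Nat.measurable_floor.comp (measurable_fst.mul measurable_snd)).prodMk measurable_fst

/-- The intensity of the points labelled by the integer part of the area south-west of them. -/
def labelIntensity : Measure (ℕ × ℝ) :=
  quadrantMeasure.map (fun p : ℝ × ℝ => (⌊p.1 * p.2⌋₊, p.1))

/-- For fixed `t > 0`, the heights `x` with `⌊t * x⌋₊ = k` have length `1 / t` whatever `k` is;
integrate over `t`. -/
lemma labelIntensity_prod (k : ℕ) {B : Set ℝ} (hB : MeasurableSet B) :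
    labelIntensity ({k} ×ˢ B) = scaleInvariantMeasure 1 B := by
  have hm : MeasurableSet ((fun p : ℝ × ℝ => (⌊p.1 * p.2⌋₊, p.1)) ⁻¹' ({k} ×ˢ B)) :=
    measurable_label ((measurableSet_singleton k).prod hB)
  rw [labelIntensity, Measure.map_apply measurable_label ((measurableSet_singleton k).prod hB),
    quadrantMeasure, Measure.volume_eq_prod, ← Measure.prod_restrict, Measure.prod_apply hm,
    scaleInvariantMeasure, withDensity_apply _ hB, ← lintegral_indicator hB]
  refine setLIntegral_congr_fun measurableSet_Ioi fun t ht => ?_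
  have ht : 0 < t := ht
  by_cases htB : t ∈ B
  · rw [indicator_of_mem htB, ← volume_floor_mul_eq ht k]
    congr 1
    ext x
    simp [htB]
  · rw [indicator_of_notMem htB]
    have : Prod.mk t ⁻¹' ((fun p : ℝ × ℝ => (⌊p.1 * p.2⌋₊, p.1)) ⁻¹' ({k} ×ˢ B)) = ∅ := by
      ext x
      simp [htB]
    rw [this, measure_empty]

lemma scaleInvariantMeasure_Ico {a b : ℝ} (ha : 0 < a) (hab : a ≤ b) :
    scaleInvariantMeasure 1 (Ico a b) = ENNReal.ofReal (Real.log (b / a)) := by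
  have hsub : Ico a b ∩ Ioi 0 = Ico a b := inter_eq_left.2 fun t ht => ha.trans_le ht.1
  have hint : IntegrableOn (fun t : ℝ => 1 / t) (Ico a b) := by
    refine (ContinuousOn.integrableOn_Icc ?_).mono_set Ico_subset_Icc_self
    exact continuousOn_const.div continuousOn_id fun t ht => (ha.trans_le ht.1).ne'
  rw [scaleInvariantMeasure, withDensity_apply _ measurableSet_Ico,
    Measure.restrict_restrict measurableSet_Ico, hsub,
    ← ofReal_integral_eq_lintegral_ofReal hint, integral_Ico_eq_integral_Ioc,
    ← intervalIntegral.integral_of_le hab, integral_one_div_of_pos ha (ha.trans_le hab)]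
  filter_upwards [ae_restrict_mem measurableSet_Ico] with t ht
  have := ha.trans_le ht.1
  simp only [Pi.zero_apply]
  positivity

lemma scaleInvariantMeasure_dyadic (n : ℕ) {i : ℕ} (hi : i ≠ 0) :
    scaleInvariantMeasure 1 {t | dyadic n t = i} =
      ENNReal.ofReal (Real.log ((i + 1 : ℝ) / i)) := by
  have hi' : (0 : ℝ) < i := by positivity
  have h : {t : ℝ | dyadic n t = i} = Ico ((i : ℝ) / 2 ^ n) (((i : ℝ) + 1) / 2 ^ n) := by
    rw [← setOf_floor_mul_eq_inter (by positivity), eq_comm]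
    refine inter_eq_left.2 fun t ht => ?_
    by_contra h0
    have h1 : ⌊(2 : ℝ) ^ n * t⌋₊ = 0 := Nat.floor_of_nonpos
      (mul_nonpos_of_nonneg_of_nonpos (by positivity) (not_le.1 h0).le)
    exact hi (ht.symm.trans h1)
  rw [h, scaleInvariantMeasure_Ico (by positivity) (by gcongr; linarith)]
  congr 2
  field_simp

/-- At `i = 0` the division and the logarithm both take the default value 0, so no positivity
assumption is needed. -/
lemma log_succ_div_nonneg (i : ℕ) : 0 ≤ Real.log ((i + 1 : ℝ) / i) := by
  rcases Nat.eq_zero_or_pos i with rfl | hi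
  · simp
  · have : (0 : ℝ) < i := by positivity
    exact Real.log_nonneg ((one_le_div this).2 (by linarith))

lemma labelIntensity_gridSet (n : ℕ) (A : ℕ → Finset ℕ) (hA : A 0 = ∅) (I : ℕ) :
    labelIntensity (gridSet n A I) =
      ENNReal.ofReal (∑ i ∈ Finset.range I, (A i).card * Real.log ((i + 1 : ℝ) / i)) := by
  have hU : gridSet n A I = ⋃ q ∈ (Finset.range I).sigma A, {q.2} ×ˢ {t | dyadic n t = q.1} := by
    ext ⟨k, t⟩
    simp only [gridSet, mem_ofPred_eq, mem_iUnion, Finset.mem_sigma, Finset.mem_range, mem_prod,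
      mem_singleton_iff, exists_prop, Sigma.exists]
    constructor
    · rintro ⟨h1, h2⟩
      exact ⟨_, _, ⟨h1, h2⟩, rfl, rfl⟩
    · rintro ⟨i, k', ⟨h1, h2⟩, rfl, rfl⟩
      exact ⟨h1, h2⟩
  rw [hU, measure_biUnion_finset]
  · rw [Finset.sum_sigma, ENNReal.ofReal_sum_of_nonneg fun i _ =>
      mul_nonneg (Nat.cast_nonneg _) (log_succ_div_nonneg i)]
    refine Finset.sum_congr rfl fun i _ => ?_
    rcases eq_or_ne i 0 with rfl | hi
    · simp [hA]
    · simp_rw [labelIntensity_prod _ (measurableSet_dyadic_eq n i),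
        scaleInvariantMeasure_dyadic n hi]
      rw [Finset.sum_const, nsmul_eq_mul, ENNReal.ofReal_mul (Nat.cast_nonneg _),
        ENNReal.ofReal_natCast]
  · rintro ⟨i, k⟩ _ ⟨i', k'⟩ _ hne
    rw [Function.onFun, disjoint_left]
    rintro ⟨l, t⟩ ⟨h1, h2⟩ ⟨h3, h4⟩
    simp only [mem_singleton_iff] at h1 h3
    have h2 : dyadic n t = i := h2
    have h4 : dyadic n t = i' := h4
    subst h1 h2 h3 h4
    exact hne rfl
  · exact fun q _ => (measurableSet_singleton _).prod (measurableSet_dyadic_eq n q.1)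

/-- The right-hand side is the limit found in `tendsto_avoidProb_refine`. By scale invariance the
level `n` does not enter. -/
lemma exp_neg_labelIntensity_gridSet (n : ℕ) (A : ℕ → Finset ℕ) (hA : A 0 = ∅) (I : ℕ) :
    Real.exp (-(labelIntensity (gridSet n A I)).toReal) =
      ∏ i ∈ Finset.range I, ((i : ℝ) / (i + 1)) ^ (A i).card := by
  rw [labelIntensity_gridSet n A hA, ENNReal.toReal_ofReal
    (Finset.sum_nonneg fun i _ => mul_nonneg (Nat.cast_nonneg _) (log_succ_div_nonneg i)),
    ← Finset.sum_neg_distrib,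
    Real.exp_sum]
  refine Finset.prod_congr rfl fun i _ => ?_
  rcases eq_or_ne i 0 with rfl | hi
  · simp [hA]
  · have : (0 : ℝ) < i := by positivity
    rw [← mul_neg, ← Real.log_inv, inv_div, Real.exp_nat_mul, Real.exp_log (by positivity)]

lemma labelIntensity_ne_top {U : Set (ℕ × ℝ)} (hU : U ∈ gridSets) : labelIntensity U ≠ ∞ := by
  obtain ⟨n, A, I, hA, rfl⟩ := hU
  rw [labelIntensity_gridSet n A hA]
  exact ENNReal.ofReal_ne_top

section Planar

variable {Ω : Type*} [MeasurableSpace Ω] {μ : Measure Ω} {P : Ω → Set (ℝ × ℝ)}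

lemma IsPoissonProcess.labelSet (hP : IsPoissonProcess P quadrantMeasure μ) :
    IsPoissonProcess (fun ω => labelSet (P ω)) labelIntensity μ := by
  refine hP.of_encard_eq (fun B => (fun p : ℝ × ℝ => (⌊p.1 * p.2⌋₊, p.1)) ⁻¹' B)
    (fun B hB => measurable_label hB) (fun B C h => h.preimage _)
    (fun B hB => (Measure.map_apply measurable_label hB).symm) ?_
  filter_upwards [hP.ae_isGood] with ω hω B _
  rw [Records.labelSet, ← image_inter_preimage, InjOn.encard_image]
  intro p hp q hq hpq
  exact hω.injOn_fst hp.1 hq.1 (Prod.ext_iff.1 hpq).2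

/-! ### Void probabilities of the records -/

lemma measurable_encard_inter (hm : Measurable (fun ω => counts (P ω))) {B : Set (ℝ × ℝ)}
    (hB : MeasurableSet B) : Measurable (fun ω => (P ω ∩ B).encard) :=
  (measurable_pi_apply (⟨B, hB⟩ : {B : Set (ℝ × ℝ) // MeasurableSet B})).comp hm

lemma occGrid_eq_true_iff {m N I : ℕ} {S : Set (ℝ × ℝ)} {j : Fin N} {i : Fin I} :
    occGrid m N I S j i = true ↔ (S ∩ cell m i j).encard ≠ 0 := by
  rw [encard_ne_zero]
  simp only [occGrid, decide_eq_true_eq]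
  rfl

lemma measurable_occGrid (hm : Measurable (fun ω => counts (P ω))) (m N I : ℕ) :
    Measurable (fun ω => occGrid m N I (P ω)) := by
  refine measurable_pi_lambda _ fun j => measurable_pi_lambda _ fun i => ?_
  refine measurable_to_bool ?_
  have : (fun ω => occGrid m N I (P ω) j i) ⁻¹' {true} =
      (fun ω => (P ω ∩ cell m i j).encard) ⁻¹' {0}ᶜ := by
    ext ω
    exact occGrid_eq_true_iff
  rw [this]
  exact measurable_encard_inter hm (measurableSet_cell m i j) .of_discrete

/-- The cells of a grid are occupied independently. -/
lemma IsPoissonProcess.measureReal_occGrid (hP : IsPoissonProcess P quadrantMeasure μ) (m N I : ℕ)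
    (β : Fin N → Fin I → Bool) :
    μ.real {ω | occGrid m N I (P ω) = β} =
      ∏ j, columnWeight (Real.exp (-((1 / 4) ^ m))) (β j) := by
  classical
  have hind : iIndepFun (fun (q : Fin N × Fin I) ω => (P ω ∩ cell m q.2 q.1).encard) μ := by
    -- Independence is available for families indexed by `Fin n`, so the cells are enumerated.
    rw [← iIndepFun_precomp_of_bijective (finProdFinEquiv (m := N) (n := I)).symm.bijective]
    refine hP.iIndepFun_encard (N * I) (fun l => cell m (finProdFinEquiv.symm l).2
      (finProdFinEquiv.symm l).1) (fun l => measurableSet_cell _ _ _) fun l l' hl => ?_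
    refine disjoint_left.2 ?_
    rintro p ⟨h1, h2⟩ ⟨h3, h4⟩
    refine hl (finProdFinEquiv.symm.injective (Prod.ext ?_ ?_))
    · exact Fin.ext (h2.symm.trans h4)
    · exact Fin.ext (h1.symm.trans h3)
  have hset : {ω | occGrid m N I (P ω) = β} = ⋂ q ∈ (Finset.univ : Finset (Fin N × Fin I)),
      (fun ω => (P ω ∩ cell m q.2 q.1).encard) ⁻¹' (if β q.1 q.2 = true then {0}ᶜ else {0}) := by
    ext ω
    simp only [mem_ofPred_eq, Finset.mem_univ, iInter_true, mem_iInter, Prod.forall, funext_iff,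
      mem_preimage]
    refine forall_congr' fun j => forall_congr' fun i => ?_
    rw [Bool.eq_iff_iff, occGrid_eq_true_iff]
    by_cases hb : β j i = true
    · simp [hb]
    · simp [hb]
  have hne : ENNReal.ofReal ((1 / 4 : ℝ) ^ m) ≠ ∞ := ENNReal.ofReal_ne_top
  have h01 : Real.exp (-((1 / 4 : ℝ) ^ m)) ≤ 1 := by
    rw [Real.exp_le_one_iff, neg_nonpos]
    positivity
  have hcell : ∀ q : Fin N × Fin I,
      μ ((fun ω => (P ω ∩ cell m q.2 q.1).encard) ⁻¹' (if β q.1 q.2 = true then {0}ᶜ else {0})) =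
        ENNReal.ofReal (if β q.1 q.2 = true then 1 - Real.exp (-((1 / 4) ^ m))
          else Real.exp (-((1 / 4) ^ m))) := by
    intro q
    have := hP.measure_encard_mem (measurableSet_cell m q.2 q.1)
      (if β q.1 q.2 = true then {0}ᶜ else {0})
    refine this.trans ?_
    rw [quadrantMeasure_cell]
    split_ifs
    · rw [prob_compl_eq_one_sub .of_discrete, poissonLaw_singleton_zero hne,
        ENNReal.toReal_ofReal (by positivity), ← ENNReal.ofReal_one,
        ← ENNReal.ofReal_sub _ (Real.exp_pos _).le]
    · rw [poissonLaw_singleton_zero hne, ENNReal.toReal_ofReal (by positivity)]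
  rw [measureReal_def, hset, hind.measure_inter_preimage_eq_mul _ fun _ _ => .of_discrete,
    Finset.prod_congr rfl fun q _ => hcell q, ENNReal.toReal_prod, Fintype.prod_prod_type]
  refine Finset.prod_congr rfl fun j _ => Finset.prod_congr rfl fun i _ => ?_
  rw [ENNReal.toReal_ofReal]
  dsimp only
  split_ifs
  · linarith
  · positivity

lemma integral_gridValue [IsProbabilityMeasure μ] (hm : Measurable (fun ω => counts (P ω)))
    (hP : IsPoissonProcess P quadrantMeasure μ) (m N I : ℕ) (A : ℕ → Finset ℕ) (hA : A 0 = ∅) :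
    ∫ ω, gridValue (Real.exp (-((1 / 4) ^ m))) A (fun _ => 0) (occGrid m N I (P ω)) ∂μ =
      avoidProb (Real.exp (-((1 / 4) ^ m))) A I (fun _ => 0) := by
  have h1 : Real.exp (-((1 / 4 : ℝ) ^ m)) < 1 := by
    rw [Real.exp_lt_one_iff, neg_lt_zero]
    positivity
  have hmeas := measurable_occGrid hm m N I
  rw [← sum_gridValue (Real.exp_pos _) h1 A hA N I, ← integral_map (f := fun β =>
    gridValue (Real.exp (-((1 / 4) ^ m))) A (fun _ => 0) β) hmeas.aemeasurable
    (measurable_of_finite _).aestronglyMeasurable, integral_fintype Integrable.of_finite]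
  refine Finset.sum_congr rfl fun β _ => ?_
  rw [map_measureReal_apply hmeas (measurableSet_singleton β), smul_eq_mul,
    ← hP.measureReal_occGrid]
  rfl

lemma keepProb_nonneg {r : ℝ} (h0 : 0 < r) (h1 : r < 1) (i : ℕ) : 0 ≤ keepProb r i := by
  rcases eq_or_ne i 0 with rfl | hi
  · simp [keepProb]
  · exact (keepProb_pos h0 h1 hi).le

lemma keepProb_le_one {r : ℝ} (h0 : 0 < r) (h1 : r < 1) (i : ℕ) : keepProb r i ≤ 1 := by
  have := pow_lt_one_of_unit h0 h1 (Nat.succ_ne_zero i)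
  simp only [Nat.succ_eq_add_one] at this
  rw [keepProb, div_le_one (by linarith), pow_succ]
  linarith [mul_comm r (r ^ i)]

lemma abs_gridValue_le_one {r : ℝ} (h0 : 0 < r) (h1 : r < 1) (A : ℕ → Finset ℕ) {n I : ℕ}
    (c : ℕ → ℕ) (β : Fin n → Fin I → Bool) : |gridValue r A c β| ≤ 1 := by
  rw [gridValue]
  split_ifs
  · simp
  · have h := fun i : Fin I => keepProb_nonneg h0 h1 i
    rw [avoidProb, abs_of_nonneg (Finset.prod_nonneg fun i _ => pow_nonneg (h i) _)]
    exact Finset.prod_le_one (fun i _ => pow_nonneg (keepProb_nonneg h0 h1 i) _)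
      fun i _ => pow_le_one₀ (keepProb_nonneg h0 h1 i) (keepProb_le_one h0 h1 i)

lemma isConf_recordSet {S : Set (ℝ × ℝ)} (h : IsGood S ∨ S = ∅) : IsConf (recordSet S) := by
  rcases h with h | rfl
  · exact h.isConf_recordSet
  · exact isConf_empty.mono fun q ⟨x, hx, _⟩ => hx

lemma isConf_labelSet {S : Set (ℝ × ℝ)} (h : IsGood S ∨ S = ∅) : IsConf (labelSet S) := by
  rcases h with h | rfl
  · exact h.isConf_labelSet
  · exact isConf_empty.mono (by simp [labelSet])

/-- The void event is the lower limit of the events that the grid of level `n + e` has no violation,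
each of which depends on finitely many counts. -/
lemma measurableSet_recordSet_void (hm : Measurable (fun ω => counts (P ω)))
    (hgood : ∀ ω, IsGood (P ω) ∨ P ω = ∅) {U : Set (ℕ × ℝ)} (hU : U ∈ gridSets) :
    MeasurableSet {ω | recordSet (P ω) ∩ U = ∅} := by
  obtain ⟨n, A, I, hA, rfl⟩ := hU
  have : {ω | recordSet (P ω) ∩ gridSet n A I = ∅} = {ω | ∀ᶠ e in atTop,
      ¬ Violates (fun i => A (i / 2 ^ e)) (fun _ => 0)
        (occGrid (n + e) ((n + e) * 2 ^ (n + e)) (I * 2 ^ e) (P ω))} := by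
    ext ω
    simp only [mem_ofPred_eq]
    rcases hgood ω with h | h
    · rw [← not_nonempty_iff_eq_empty]
      have hev := h.eventually_grid n A I hA
      constructor
      · intro hv
        filter_upwards [hev] with e he
        rwa [he.1]
      · intro hv
        obtain ⟨e, h1, h2⟩ := (hv.and hev).exists
        rwa [h2.1] at h1
    · rw [h]
      have h1 : recordSet ∅ = ∅ := by
        rw [eq_empty_iff_forall_notMem]
        rintro q ⟨x, hx, -⟩
        exact hx
      simp only [h1, empty_inter, true_iff]
      refine Eventually.of_forall fun e => ?_
      rintro ⟨j, i, hij, -⟩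
      simp [occGrid] at hij
  have hev : ∀ e, MeasurableSet {ω | ¬ Violates (fun i => A (i / 2 ^ e)) (fun _ => 0)
      (occGrid (n + e) ((n + e) * 2 ^ (n + e)) (I * 2 ^ e) (P ω))} := fun e =>
    measurable_occGrid hm _ _ _ (MeasurableSet.of_discrete (s := {β | ¬ Violates _ _ β}))
  have hunion : {ω | recordSet (P ω) ∩ gridSet n A I = ∅} = ⋃ N, ⋂ e ≥ N,
      {ω | ¬ Violates (fun i => A (i / 2 ^ e)) (fun _ => 0)
        (occGrid (n + e) ((n + e) * 2 ^ (n + e)) (I * 2 ^ e) (P ω))} := by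
    rw [this]
    ext ω
    simp only [eventually_atTop, mem_ofPred_eq, mem_iUnion, mem_iInter]
  rw [hunion]
  exact MeasurableSet.iUnion fun N => MeasurableSet.iInter fun e => MeasurableSet.iInter fun _ =>
    hev e

/-- The mean of `gridValue` is computed in two ways: exactly, as `avoidProb`, and in the limit, by
dominated convergence with bound 1, as the void probability. -/
lemma measure_recordSet_void [IsProbabilityMeasure μ] (hm : Measurable (fun ω => counts (P ω)))
    (hP : IsPoissonProcess P quadrantMeasure μ) (hgood : ∀ ω, IsGood (P ω) ∨ P ω = ∅)
    {U : Set (ℕ × ℝ)} (hU : U ∈ gridSets) :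
    μ {ω | recordSet (P ω) ∩ U = ∅} =
      ENNReal.ofReal (Real.exp (-(labelIntensity U).toReal)) := by
  classical
  have hmeas := measurableSet_recordSet_void hm hgood hU
  obtain ⟨n, A, I, hA, rfl⟩ := hU
  rw [exp_neg_labelIntensity_gridSet n A hA, ← ofReal_measureReal]
  congr 1
  have hr : ∀ m : ℕ, Real.exp (-((1 / 4 : ℝ) ^ m)) < 1 := by
    intro m
    rw [Real.exp_lt_one_iff, neg_lt_zero]
    positivity
  have hlim : Tendsto (fun e : ℕ => ∫ ω, gridValue (Real.exp (-((1 / 4) ^ (n + e))))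
      (fun i => A (i / 2 ^ e)) (fun _ => 0)
      (occGrid (n + e) ((n + e) * 2 ^ (n + e)) (I * 2 ^ e) (P ω)) ∂μ) atTop
      (𝓝 (∫ ω, {ω | recordSet (P ω) ∩ gridSet n A I = ∅}.indicator 1 ω ∂μ)) := by
    refine tendsto_integral_of_dominated_convergence (fun _ => 1) (fun e => ?_)
      (integrable_const _) (fun e => Eventually.of_forall fun ω => ?_) ?_
    · exact ((measurable_of_finite (fun β : Fin ((n + e) * 2 ^ (n + e)) → Fin (I * 2 ^ e) → Bool =>
        gridValue (Real.exp (-((1 / 4) ^ (n + e)))) (fun i => A (i / 2 ^ e)) (fun _ => 0) β)).comp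
          (measurable_occGrid hm _ _ _)).aestronglyMeasurable
    · exact abs_gridValue_le_one (Real.exp_pos _) (hr _) _ _ _
    · filter_upwards [hP.ae_isGood] with ω hω
      refine tendsto_const_nhds.congr' ?_
      filter_upwards [hω.eventually_gridValue n A I hA
        (fun e => Real.exp (-((1 / 4) ^ (n + e))))] with e he
      rw [he, indicator_apply]
      rfl
  rw [integral_indicator_one hmeas] at hlim
  refine tendsto_nhds_unique hlim ?_
  refine (tendsto_avoidProb_refine A hA n I).congr fun e => ?_
  rw [integral_gridValue hm hP _ _ _ _ (by simp [hA])]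

/-- The labelled record times form a Poisson process. -/
lemma IsPoissonProcess.recordSet_of_measurable [IsProbabilityMeasure μ]
    (hm : Measurable (fun ω => counts (P ω)))
    (hP : IsPoissonProcess P quadrantMeasure μ) (hgood : ∀ ω, IsGood (P ω) ∨ P ω = ∅) :
    IsPoissonProcess (fun ω => recordSet (P ω)) labelIntensity μ := by
  let X : Ω → Conf := fun ω => ⟨recordSet (P ω), isConf_recordSet (hgood ω)⟩
  let Z : Ω → Conf := fun ω => ⟨Records.labelSet (P ω), isConf_labelSet (hgood ω)⟩
  have hX : Measurable X := measurable_conf_iff.2 fun U hU =>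
    measurableSet_recordSet_void hm hgood hU
  have hZ : Measurable Z := by
    refine measurable_conf_iff.2 fun U hU => ?_
    have : {ω | (Z ω).1 ∩ U = ∅} = (fun ω => (P ω ∩
        (fun p : ℝ × ℝ => (⌊p.1 * p.2⌋₊, p.1)) ⁻¹' U).encard) ⁻¹' {0} := by
      ext ω
      simp only [Z, mem_ofPred_eq, mem_preimage, mem_singleton_iff, encard_eq_zero,
        Records.labelSet]
      rw [← image_inter_preimage, image_eq_empty]
    rw [this]
    exact measurable_encard_inter hm (measurable_label (measurableSet_of_mem_gridSets hU))
      .of_discrete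
  -- Equal void probabilities give equal laws, so the Poisson property passes from the area labels
  -- to the ranks.
  refine IsPoissonProcess.of_map_eq hZ hX (map_conf_eq hZ hX fun U hU => ?_) hP.labelSet
  rw [measure_recordSet_void hm hP hgood hU]
  exact hP.labelSet.measure_void (measurableSet_of_mem_gridSets hU) (labelIntensity_ne_top hU)

end Planar

/-! ### Records of different ranks -/

/-- The points with label `k` whose times, with label `0`, lie in `U`. -/
def labelShift (k : ℕ) (U : Set (ℕ × ℝ)) : Set (ℕ × ℝ) := {q | q.1 = k ∧ (0, q.2) ∈ U}

lemma labelShift_gridSet (k n : ℕ) (A : ℕ → Finset ℕ) (I : ℕ) :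
    labelShift k (gridSet n A I) = gridSet n (fun i => if 0 ∈ A i then {k} else ∅) I := by
  ext ⟨k', t⟩
  simp only [labelShift, gridSet, mem_ofPred_eq]
  split_ifs with h
  · simp [h, and_comm]
  · simp [h]

lemma labelShift_mem_gridSets (k : ℕ) {U : Set (ℕ × ℝ)} (hU : U ∈ gridSets) :
    labelShift k U ∈ gridSets := by
  obtain ⟨n, A, I, hA, rfl⟩ := hU
  exact ⟨n, _, I, by simp [hA], labelShift_gridSet k n A I⟩

lemma exp_neg_labelIntensity_labelShift (j k : ℕ) {U : Set (ℕ × ℝ)} (hU : U ∈ gridSets) :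
    Real.exp (-(labelIntensity (labelShift j U)).toReal) =
      Real.exp (-(labelIntensity (labelShift k U)).toReal) := by
  obtain ⟨n, A, I, hA, rfl⟩ := hU
  rw [labelShift_gridSet, labelShift_gridSet, exp_neg_labelIntensity_gridSet _ _ (by simp [hA]),
    exp_neg_labelIntensity_gridSet _ _ (by simp [hA])]
  refine Finset.prod_congr rfl fun i _ => ?_
  split_ifs <;> simp

/-- The points with label `k`, relabelled by `0`. -/
def ofLabel (k : ℕ) (S : Conf) : Conf :=
  ⟨{q | q.1 = 0 ∧ (k, q.2) ∈ S.1}, fun q hq => S.2.pos (k, q.2) hq.2, fun n => by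
    refine ((S.2.slice_finite k n).image (Prod.mk 0)).subset ?_
    rintro ⟨l, t⟩ ⟨⟨hl, h1⟩, -, h2⟩
    simp only at hl
    subst hl
    exact ⟨t, ⟨h1, h2⟩, rfl⟩⟩

lemma ofLabel_inter_eq_empty_iff (k : ℕ) (S : Conf) (U : Set (ℕ × ℝ)) :
    (ofLabel k S).1 ∩ U = ∅ ↔ S.1 ∩ labelShift k U = ∅ := by
  simp only [eq_empty_iff_forall_notMem]
  constructor
  · rintro h ⟨l, t⟩ ⟨h1, h2, h3⟩
    simp only at h2
    subst h2
    exact h (0, t) ⟨⟨rfl, h1⟩, h3⟩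
  · rintro h ⟨l, t⟩ ⟨⟨h1, h2⟩, h3⟩
    simp only at h1
    subst h1
    exact h (k, t) ⟨h2, rfl, h3⟩

lemma measurable_ofLabel (k : ℕ) : Measurable (ofLabel k) := by
  refine measurable_conf_iff.2 fun U hU => ?_
  simp_rw [ofLabel_inter_eq_empty_iff]
  exact measurableSet_voidEvent (labelShift_mem_gridSets k hU)

lemma encard_section_inter (S : Set (ℕ × ℝ)) (k : ℕ) (B : Set ℝ) :
    ({t | (k, t) ∈ S} ∩ B).encard = (S ∩ {k} ×ˢ B).encard := by
  have : S ∩ {k} ×ˢ B = Prod.mk k '' ({t | (k, t) ∈ S} ∩ B) := by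
    ext ⟨l, t⟩
    simp only [mem_inter_iff, mem_prod, mem_singleton_iff, mem_image, mem_ofPred_eq,
      Prod.mk.injEq]
    constructor
    · rintro ⟨h1, rfl, h2⟩
      exact ⟨t, ⟨h1, h2⟩, rfl, rfl⟩
    · rintro ⟨t, ⟨h1, h2⟩, rfl, rfl⟩
      exact ⟨h1, rfl, h2⟩
  rw [this, (Prod.mk_right_injective k).encard_image]

lemma measurable_counts_section : Measurable (fun S : Conf => counts {t | (0, t) ∈ S.1}) := by
  refine measurable_pi_lambda _ fun B => ?_
  simp_rw [counts, encard_section_inter]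
  exact measurable_encard_conf ((measurableSet_singleton _).prod B.2)

lemma section_ofLabel (k : ℕ) (S : Conf) : {t | (0, t) ∈ (ofLabel k S).1} = {t | (k, t) ∈ S.1} := by
  ext t
  exact and_iff_right rfl

section ConfProcess

variable {Ω : Type*} [MeasurableSpace Ω] {μ : Measure Ω} {X : Ω → Conf}

/-- It is enough to test independence on void events. Avoiding sets with different labels is
avoiding their disjoint union, and the exponential turns the sum of the intensities into a product.
-/
lemma iIndepFun_ofLabel (hX : Measurable X)
    (h : IsPoissonProcess (fun ω => (X ω).1) labelIntensity μ) :
    iIndepFun (fun k ω => ofLabel k (X ω)) μ := by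
  rw [iIndepFun_iff_iIndep]
  refine iIndepSets.iIndep (fun k => ((measurable_ofLabel k).comp hX).comap_le)
    (fun k => preimage (fun ω => ofLabel k (X ω)) '' voidEvents)
    (fun k => ?_) (fun k => MeasurableSpace.comap_generateFrom) ?_
  · rintro _ ⟨s, hs, rfl⟩ _ ⟨t, ht, rfl⟩ ⟨ω, hω⟩
    exact ⟨s ∩ t, isPiSystem_voidEvents s hs t ht ⟨_, hω⟩, rfl⟩
  · rw [iIndepSets_iff]
    intro s f hf
    have hf' : ∀ k, ∃ U, U ∈ gridSets ∧
        (k ∈ s → f k = {ω | (X ω).1 ∩ labelShift k U = ∅}) := by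
      intro k
      by_cases hk : k ∈ s
      · obtain ⟨_, ⟨U, hU, rfl⟩, hUf⟩ := hf k hk
        refine ⟨U, hU, fun _ => ?_⟩
        rw [← hUf]
        ext ω
        exact ofLabel_inter_eq_empty_iff k (X ω) U
      -- A filler for the indices outside `s`.
      · exact ⟨∅, ⟨0, fun _ => ∅, 0, rfl, by simp [gridSet]⟩, fun h => absurd h hk⟩
    choose U hU hfU using hf'
    have hS := fun k => labelShift_mem_gridSets k (hU k)
    have hm := fun k => measurableSet_of_mem_gridSets (hS k)
    have hfin := fun k => labelIntensity_ne_top (hS k)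
    have hinter : ⋂ k ∈ s, f k = {ω | (X ω).1 ∩ ⋃ k ∈ s, labelShift k (U k) = ∅} := by
      ext ω
      simp only [inter_iUnion, iUnion_eq_empty, mem_iInter, mem_ofPred_eq]
      refine forall_congr' fun k => forall_congr' fun hk => ?_
      rw [hfU k hk]
      rfl
    have hsum : labelIntensity (⋃ k ∈ s, labelShift k (U k)) =
        ∑ k ∈ s, labelIntensity (labelShift k (U k)) := by
      refine measure_biUnion_finset (fun j _ k _ hjk => ?_) fun k _ => hm k
      exact disjoint_left.2 fun q h1 h2 => hjk (h1.1.symm.trans h2.1)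
    rw [hinter, h.measure_void (s.measurableSet_biUnion fun k _ => hm k)
      (by rw [hsum]; exact ENNReal.sum_ne_top.2 fun k _ => hfin k), hsum,
      ENNReal.toReal_sum fun k _ => hfin k, ← Finset.sum_neg_distrib, Real.exp_sum,
      ENNReal.ofReal_prod_of_nonneg fun k _ => (Real.exp_pos _).le]
    refine Finset.prod_congr rfl fun k hk => ?_
    rw [hfU k hk, h.measure_void (hm k) (hfin k)]

lemma map_ofLabel_eq [IsProbabilityMeasure μ] (hX : Measurable X)
    (h : IsPoissonProcess (fun ω => (X ω).1) labelIntensity μ) (j k : ℕ) :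
    μ.map (fun ω => ofLabel j (X ω)) = μ.map (fun ω => ofLabel k (X ω)) := by
  refine map_conf_eq ((measurable_ofLabel j).comp hX) ((measurable_ofLabel k).comp hX)
    fun U hU => ?_
  have hv : ∀ l, μ {ω | (ofLabel l (X ω)).1 ∩ U = ∅} =
      ENNReal.ofReal (Real.exp (-(labelIntensity (labelShift l U)).toReal)) := by
    intro l
    have hl := labelShift_mem_gridSets l hU
    simp_rw [ofLabel_inter_eq_empty_iff]
    exact h.measure_void (measurableSet_of_mem_gridSets hl) (labelIntensity_ne_top hl)
  rw [hv, hv, exp_neg_labelIntensity_labelShift j k hU]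

end ConfProcess

/-! ### Records and corners of the planar process, in the time coordinate -/

section Planar

variable {Ω : Type*} [MeasurableSpace Ω] {μ : Measure Ω} {P : Ω → Set (ℝ × ℝ)}

/-- A planar Poisson process has a modification with measurable counts, all of whose realizations
are good or empty. -/
lemma IsPoissonProcess.exists_modification (hP : IsPoissonProcess P quadrantMeasure μ) :
    ∃ P' : Ω → Set (ℝ × ℝ), (∀ᵐ ω ∂μ, P ω = P' ω) ∧ Measurable (fun ω => counts (P' ω)) ∧
      ∀ ω, IsGood (P' ω) ∨ P' ω = ∅ := by
  classical
  obtain ⟨t, ht, htm, hgood⟩ :=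
    (hP.aemeasurable_counts.ae_eq_mk.and hP.ae_isGood).exists_measurable_mem
  refine ⟨fun ω => if ω ∈ t then P ω else ∅, ?_, ?_, fun ω => ?_⟩
  · filter_upwards [ht] with ω hω
    rw [if_pos hω]
  · have : (fun ω => counts (if ω ∈ t then P ω else ∅)) =
        t.piecewise (hP.aemeasurable_counts.mk _) (fun _ => counts ∅) := by
      funext ω
      by_cases hω : ω ∈ t
      · rw [if_pos hω, piecewise_eq_of_mem _ _ _ hω]
        exact (hgood ω hω).1
      · rw [if_neg hω, piecewise_eq_of_notMem _ _ _ hω]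
    rw [this]
    exact hP.aemeasurable_counts.measurable_mk.piecewise htm measurable_const
  · by_cases hω : ω ∈ t
    · exact Or.inl (by simpa only [if_pos hω] using (hgood ω hω).2)
    · exact Or.inr (if_neg hω)

lemma fst_image_kRecords_pnat (S : Set (ℝ × ℝ)) (k : ℕ+) :
    Prod.fst '' kRecords S k = {t | (k.natPred, t) ∈ recordSet S} := by
  rw [← fst_image_kRecords, PNat.natPred_add_one]

variable [IsProbabilityMeasure μ]

/-- The labelled record times of a planar Poisson process are almost surely those of a measurable
family of configurations. -/
lemma IsPoissonProcess.exists_conf (hP : IsPoissonProcess P quadrantMeasure μ) :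
    ∃ X : Ω → Conf, Measurable X ∧ IsPoissonProcess (fun ω => (X ω).1) labelIntensity μ ∧
      ∀ᵐ ω ∂μ, recordSet (P ω) = (X ω).1 := by
  obtain ⟨P', hPP', hm, hgood⟩ := hP.exists_modification
  have hP' : IsPoissonProcess P' quadrantMeasure μ := hP.congr (hPP'.mono fun ω h => h.symm)
  refine ⟨fun ω => ⟨recordSet (P' ω), isConf_recordSet (hgood ω)⟩, ?_, ?_, ?_⟩
  · exact measurable_conf_iff.2 fun U hU => measurableSet_recordSet_void hm hgood hU
  · exact hP'.recordSet_of_measurable hm hgood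
  · filter_upwards [hPP'] with ω hω
    rw [hω]

theorem IsPoissonProcess.isIIDPoisson_fst_kRecords (hP : IsPoissonProcess P quadrantMeasure μ) :
    IsIIDPoisson (fun (k : ℕ+) ω => Prod.fst '' kRecords (P ω) k) (scaleInvariantMeasure 1) μ := by
  obtain ⟨X, hX, hXP, hPX⟩ := hP.exists_conf
  have hcounts : ∀ k : ℕ+, ∀ᵐ ω ∂μ, counts (Prod.fst '' kRecords (P ω) k) =
      counts {t | (0, t) ∈ (ofLabel k.natPred (X ω)).1} := by
    intro k
    filter_upwards [hPX] with ω hω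
    rw [fst_image_kRecords_pnat, hω, section_ofLabel]
  have hmeas : ∀ k : ℕ+, AEMeasurable (fun ω => counts (Prod.fst '' kRecords (P ω) k)) μ := by
    intro k
    refine AEMeasurable.congr ?_ ((hcounts k).mono fun ω h => h.symm)
    exact (measurable_counts_section.comp ((measurable_ofLabel _).comp hX)).aemeasurable
  refine ⟨fun k => ?_, fun j k => ⟨hmeas j, hmeas k, ?_⟩, ?_⟩
  · refine hXP.of_encard_eq (fun B => {k.natPred} ×ˢ B)
      (fun B hB => (measurableSet_singleton _).prod hB)
      (fun B C h => disjoint_left.2 fun q h1 h2 => disjoint_left.1 h h1.2 h2.2)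
      (fun B hB => labelIntensity_prod _ hB) ?_
    filter_upwards [hPX] with ω hω B _
    rw [fst_image_kRecords_pnat, hω, encard_section_inter]
  · rw [Measure.map_congr (hcounts j), Measure.map_congr (hcounts k)]
    have h1 := fun l => Measure.map_map (μ := μ) measurable_counts_section
      ((measurable_ofLabel l).comp hX)
    refine (h1 j.natPred).symm.trans (Eq.trans ?_ (h1 k.natPred))
    exact congrArg _ (map_ofLabel_eq hX hXP _ _)
  -- Since all labels were replaced by 0, a single measurable functional recovers the counts for
  -- every `k`.
  · have hind := ((iIndepFun_ofLabel hX hXP).precomp PNat.natPred_injective).comp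
      (fun _ S => counts {t | (0, t) ∈ S.1}) fun _ => measurable_counts_section
    exact hind.congr fun k => (hcounts k).mono fun ω h => h.symm

lemma scaleInvariantMeasure_natCast (k : ℕ) (B : Set ℝ) (hB : MeasurableSet B) :
    scaleInvariantMeasure k B = k * scaleInvariantMeasure 1 B := by
  rw [scaleInvariantMeasure, scaleInvariantMeasure, withDensity_apply _ hB, withDensity_apply _ hB,
    ← lintegral_const_mul' _ _ (ENNReal.natCast_ne_top k)]
  refine lintegral_congr fun t => ?_
  rw [← ENNReal.ofReal_natCast, ← ENNReal.ofReal_mul (Nat.cast_nonneg k), mul_one_div]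

lemma labelIntensity_Iic_prod (k : ℕ) {B : Set ℝ} (hB : MeasurableSet B) :
    labelIntensity (Iic k ×ˢ B) = scaleInvariantMeasure ((k + 1 : ℕ) : ℝ) B := by
  have : Iic k ×ˢ B = ⋃ r ∈ Finset.range (k + 1), {r} ×ˢ B := by
    ext ⟨r, t⟩
    simp
  rw [this, measure_biUnion_finset, Finset.sum_congr rfl fun r _ => labelIntensity_prod r hB,
    Finset.sum_const, Finset.card_range, nsmul_eq_mul, scaleInvariantMeasure_natCast _ _ hB]
  · intro r _ r' _ hne
    exact disjoint_left.2 fun q h1 h2 => hne (h1.1.symm.trans h2.1)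
  · exact fun r _ => (measurableSet_singleton r).prod hB

/-- Corner times collect the record times of the `k` lowest ranks. They form the projection of the
labelled process restricted to `k` labels, which adds up `k` copies of the intensity. -/
theorem IsPoissonProcess.fst_kCorners (hP : IsPoissonProcess P quadrantMeasure μ) (k : ℕ+) :
    IsPoissonProcess (fun ω => Prod.fst '' kCorners (P ω) k) (scaleInvariantMeasure k) μ := by
  obtain ⟨X, hX, hXP, hPX⟩ := hP.exists_conf
  rw [← PNat.natPred_add_one k]
  refine hXP.of_encard_eq (fun B => Iic k.natPred ×ˢ B) (fun B hB => measurableSet_Iic.prod hB)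
    (fun B C h => disjoint_left.2 fun q h1 h2 => disjoint_left.1 h h1.2 h2.2)
    (fun B hB => labelIntensity_Iic_prod _ hB) ?_
  filter_upwards [hPX, hP.ae_isGood] with ω hω hgood B _
  rw [hgood.fst_image_kCorners, ← hω]
  have : {t | ∃ r ≤ k.natPred, (r, t) ∈ recordSet (P ω)} ∩ B =
      Prod.snd '' (recordSet (P ω) ∩ Iic k.natPred ×ˢ B) := by
    ext t
    constructor
    · rintro ⟨⟨r, hr, hrt⟩, hB⟩
      exact ⟨(r, t), ⟨hrt, hr, hB⟩, rfl⟩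
    · rintro ⟨⟨r, t⟩, ⟨hrt, hr, hB⟩, rfl⟩
      exact ⟨⟨r, hr, hrt⟩, hB⟩
  rw [this, InjOn.encard_image (hgood.injOn_snd_recordSet.mono inter_subset_left)]

end Planar

/-! ### Exchanging the coordinates -/

lemma mem_swap_image_iff {S : Set (ℝ × ℝ)} {a : ℝ × ℝ} : a ∈ Prod.swap '' S ↔ a.swap ∈ S := by
  rw [image_swap_eq_preimage_swap, mem_preimage]

lemma encard_southWest_swap (S : Set (ℝ × ℝ)) (a : ℝ × ℝ) :
    (southWest (Prod.swap '' S) a).encard = (southWest S a.swap).encard := by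
  have : southWest (Prod.swap '' S) a = Prod.swap '' southWest S a.swap := by
    ext b
    rw [mem_swap_image_iff]
    simp only [southWest, mem_ofPred_eq, mem_swap_image_iff, Prod.fst_swap, Prod.snd_swap]
    rw [and_comm (a := b.1 < a.1)]
  rw [this, Prod.swap_injective.encard_image]

lemma kRecords_swap (S : Set (ℝ × ℝ)) (k : ℕ) :
    kRecords (Prod.swap '' S) k = Prod.swap '' kRecords S k := by
  ext a
  rw [mem_swap_image_iff]
  simp only [kRecords, mem_ofPred_eq, mem_swap_image_iff, encard_southWest_swap]

/-- Reflection in the diagonal preserves the south-west order and exchanges the western and southern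
witnesses. -/
lemma kCorners_swap (S : Set (ℝ × ℝ)) (k : ℕ) :
    kCorners (Prod.swap '' S) k = Prod.swap '' kCorners S k := by
  rw [kCorners, kCorners, image_union, kRecords_swap]
  congr 1
  ext a
  rw [mem_swap_image_iff]
  simp only [mem_ofPred_eq, mem_swap_image_iff, encard_southWest_swap, Prod.fst_swap,
    Prod.snd_swap]
  constructor
  · rintro ⟨h1, h2, ⟨c, hc, hc1, hc2⟩, d, hd, hd1, hd2⟩
    exact ⟨h1, h2, ⟨d.swap, hd, hd2, hd1⟩, c.swap, hc, hc2, hc1⟩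
  · rintro ⟨h1, h2, ⟨c, hc, hc1, hc2⟩, d, hd, hd1, hd2⟩
    exact ⟨h1, h2, ⟨d.swap, hd, hd2, hd1⟩, c.swap, hc, hc2, hc1⟩

lemma fst_image_swap_image (S : Set (ℝ × ℝ)) : Prod.fst '' (Prod.swap '' S) = Prod.snd '' S := by
  rw [image_image]
  rfl

end Records

end

theorem proposition1 {Ω : Type*} [MeasurableSpace Ω] (μ : MeasureTheory.Measure Ω)
    [MeasureTheory.IsProbabilityMeasure μ] (P : Ω → Set (ℝ × ℝ))
    (hP : Records.IsPoissonProcess P Records.quadrantMeasure μ) :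
    Records.IsIIDPoisson (fun (k : ℕ+) ω => Prod.fst '' Records.kRecords (P ω) k)
      (Records.scaleInvariantMeasure 1) μ ∧
    (∀ k : ℕ+, Records.IsPoissonProcess (fun ω => Prod.fst '' Records.kCorners (P ω) k)
      (Records.scaleInvariantMeasure k) μ) ∧
    Records.IsIIDPoisson (fun (k : ℕ+) ω => Prod.snd '' Records.kRecords (P ω) k)
      (Records.scaleInvariantMeasure 1) μ ∧
    (∀ k : ℕ+, Records.IsPoissonProcess (fun ω => Prod.snd '' Records.kCorners (P ω) k)
      (Records.scaleInvariantMeasure k) μ) := by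
  refine ⟨hP.isIIDPoisson_fst_kRecords, hP.fst_kCorners, ?_, fun k => ?_⟩
  -- The reflected process is again a planar Poisson process, and its times are the heights of the
  -- original one.
  · have h := hP.swap.isIIDPoisson_fst_kRecords
    simpa only [Records.kRecords_swap, Records.fst_image_swap_image] using h
  · have h := hP.swap.fst_kCorners k
    simpa only [Records.kCorners_swap, Records.fst_image_swap_image] using h
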